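/- Let $q$ be a prime power, let $\vartheta:\mathbb F_q^+\to\mathbb C^\times$ be a nontrivial homomorphism, and let $K\subseteq L\subseteq\{1,\dots,n\}$. An *arc* on $K$ is a triple $i\overset{a}{\frown}l$ with $i<l$ in $K$ and $a\in\mathbb F_q^\times$; a *$q$-set partition* of $K$ is a finite multiset of arcs on $K$ in which distinct elements have distinct left endpoints and distinct right endpoints, and $\mathcal S_K(q)$ is the set of these. Let $\bar\mu$ be obtained from $\mu$ by negating all labels. Let $U_K$ be the group of unipotent upper-triangular $n\times n$ matrices $u$ over $\mathbb F_q$ with $u_{ij}=0$ for $i<j$ unless $i,j\in K$. The superclass of $U_K$ indexed by $\nu\in\mathcal S_K(q)$ consists of the $u\in U_K$ such that $x(u-1)y=\sum_{i\overset{a}{\frown}l\in\nu}a\,e_{il}$ for some $x,y\in U_K$; every element of $U_K$ lies in exactly one superclass. For $\lambda\in\mathcal S_K(q)$ the supercharacter of $U_K$ is $\chi^\lambda=\prod_{i\overset{a}{\frown}l\in\lambda}\chi^{i\overset{a}{\frown}l}$, where $\chi^{i\overset{a}{\frown}l}$ takes on the superclass indexed by $\nu$ the value $0$ if $\nu$ has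 an arc $j\overset{b}{\frown}k$ with $i=j<k<l$ or $i<j<k=l$, and otherwise the value $$q^{|\{j\in K:\ i<j<l\}|-|\{j\overset{b}{\frown}k\in\nu:\ i<j<k<l\}|}\ \vartheta\Big(a\sum_{i\overset{b}{\frown}l\in\nu}b\Big).$$ For a finite multiset $\nu$ of arcs on $\{1,\dots,n\}$, stack its elements as follows. Among elements with the same left endpoint, the one with the larger right endpoint starts above. Among elements with the same right endpoint, the one with the smaller left endpoint ends above. List the elements with the same two endpoints in any order $a_1,\dots,a_m$ from bottom to top; this is their order at the right endpoint, and also at the left endpoint, except that $a_{m-1}$ and $a_m$ are exchanged at the left endpoint if the labels of the $m$ elements sum to $0$. The left endpoint $j$ of an element of $\nu$ is labelled $\circ$ if $j\notin K$ or if the element starts below another element starting at $j$, and $\bullet$ otherwise; the right endpoint $k$ is labelled $\circ$ if $k\notin K$ or if the element ends below another element ending at $k$, and $\bullet$ otherwise. Let $V_\bullet$ and $V_\circ$ be the sets of elements labelled $(\bullet,\bullet)$ and $(\circ,\circ)$, and let $\Gamma_K(\nu)$ be the bipartite graph on $V_\bullet\sqcup V_\circ$ in which $j\overset{b}{\frown}k\in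 V_\bullet$ is joined to $i\overset{a}{\frown}l\in V_\circ$ when $i<j<k<l$. **Theorem.** Let $\lambda\in\mathcal S_L(q)$ and $\mu\in\mathcal S_K(q)$, and let $\lambda\cup\bar\mu$ be the multiset union, in which multiplicities are added. Then $$\big\langle\operatorname{Res}^{U_L}_{U_K}(\chi^\lambda),\chi^\mu\big\rangle\neq0$$ for the usual inner product of complex functions on $U_K$ if and only if $\Gamma_K(\lambda\cup\bar\mu)$ has a complete matching from $V_\bullet$ to $V_\circ$, that is, a matching that covers every element of $V_\bullet$. -/

import Mathlib

open scoped ComplexConjugate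

/-! Throughout, the nodes are the elements of `Fin n` (the element `i` stands for the integer
`i + 1`), the finite sets `K ⊆ L` of nodes are finsets of `Fin n` for an arbitrary `n`, `F` is the
finite field with `q` elements, and `ϑ` is a nontrivial additive character of `F`. -/

namespace Unipotent

section Arcs

variable {n : ℕ} {F : Type*} [Field F]

/-- A labelled arc from the node `left` to the node `right`, where `left < right`, with a nonzero
label in `F`. -/
@[ext]
structure Arc (n : ℕ) (F : Type*) [Field F] where
  left : Fin n
  right : Fin n
  lt : left < right
  label : F
  label_ne : label ≠ 0

/-- The arc with the same endpoints and the opposite label. -/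
def Arc.bar (α : Arc n F) : Arc n F where
  left := α.left
  right := α.right
  lt := α.lt
  label := -α.label
  label_ne := neg_ne_zero.mpr α.label_ne

/-- The multiset obtained by negating all labels. -/
def bar (lam : Multiset (Arc n F)) : Multiset (Arc n F) :=
  lam.map Arc.bar

/-- The multisets of arcs both of whose endpoints lie in `K`. -/
def arcMultisets (F : Type*) [Field F] (K : Finset (Fin n)) : Set (Multiset (Arc n F)) :=
  {lam | ∀ α ∈ lam, α.left ∈ K ∧ α.right ∈ K}

/-- The `q`-set partitions of `K`: the multisets of arcs on `K` in which two distinct elements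
(counted with multiplicity) never have the same left endpoint and never have the same right
endpoint. -/
def qSetPartitions (F : Type*) [Field F] (K : Finset (Fin n)) : Set (Multiset (Arc n F)) :=
  {lam | lam ∈ arcMultisets F K ∧ (lam.map Arc.left).Nodup ∧ (lam.map Arc.right).Nodup}

/-- The multiset of the elements of `lam` going from `j` to `k`. -/
def parallel (lam : Multiset (Arc n F)) (j k : Fin n) : Multiset (Arc n F) :=
  lam.filter fun α => α.left = j ∧ α.right = k

/-- The number of elements of `lam` going from `j` to `k`. -/
def mult (lam : Multiset (Arc n F)) (j k : Fin n) : ℕ :=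
  (parallel lam j k).card

/-- The sum of the labels of the elements of `lam` going from `j` to `k`. -/
def wt (lam : Multiset (Arc n F)) (j k : Fin n) : F :=
  ((parallel lam j k).map Arc.label).sum

end Arcs

section Groups

variable {n : ℕ}

/-- `u` is unipotent upper triangular, and its entries above the diagonal vanish outside of the
positions `(i, j)` with `i, j ∈ K`. -/
def IsUnipotentOn {F : Type*} [Field F] (K : Finset (Fin n)) (u : Matrix (Fin n) (Fin n) F) :
    Prop :=
  (∀ i, u i i = 1) ∧ (∀ i j, i < j → u j i = 0) ∧
    ∀ i j, i < j → ¬ (i ∈ K ∧ j ∈ K) → u i j = 0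

theorem isUnipotentOn_iff {F : Type*} [Field F] (K : Finset (Fin n))
    (u : Matrix (Fin n) (Fin n) F) :
    IsUnipotentOn K u ↔
      ∀ i j, ¬ (i < j ∧ i ∈ K ∧ j ∈ K) → u i j = (1 : Matrix (Fin n) (Fin n) F) i j := by
  constructor
  · rintro ⟨h1, h2, h3⟩ i j h
    rcases lt_trichotomy i j with hij | rfl | hij
    · rw [Matrix.one_apply_ne hij.ne]
      exact h3 i j hij fun hK => h ⟨hij, hK⟩
    · rw [Matrix.one_apply_eq, h1]
    · rw [Matrix.one_apply_ne hij.ne', h2 j i hij]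
  · intro h
    refine ⟨fun i => ?_, fun i j hij => ?_, fun i j hij hK => ?_⟩
    · rw [h i i (by simp), Matrix.one_apply_eq]
    · rw [h j i (fun h' => absurd h'.1 hij.asymm), Matrix.one_apply_ne hij.ne']
    · rw [h i j (fun h' => hK h'.2), Matrix.one_apply_ne hij.ne]

theorem IsUnipotentOn.mul {F : Type*} [Field F] {K : Finset (Fin n)}
    {u v : Matrix (Fin n) (Fin n) F} (hu : IsUnipotentOn K u) (hv : IsUnipotentOn K v) :
    IsUnipotentOn K (u * v) := by
  rw [isUnipotentOn_iff] at *
  intro i j h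
  rw [Matrix.mul_apply]
  by_cases hi : i ∈ K
  · by_cases hj : j ∈ K
    · have hij : ¬ i < j := fun h' => h ⟨h', hi, hj⟩
      have key : ∀ k, u i k * v k j =
          (1 : Matrix (Fin n) (Fin n) F) i k * (1 : Matrix (Fin n) (Fin n) F) k j := by
        intro k
        by_cases hik : i < k
        · have hkj : ¬ k < j := fun h' => hij (hik.trans h')
          have hne : k ≠ j := fun h' => hij (h' ▸ hik)
          rw [hv k j (fun h' => hkj h'.1), Matrix.one_apply_ne hne, mul_zero, mul_zero]
        · rw [hu i k (fun h' => hik h'.1)]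
          by_cases hik' : i = k
          · subst hik'
            rw [hv i j h]
          · rw [Matrix.one_apply_ne hik', zero_mul, zero_mul]
      simp_rw [key]
      rw [← Matrix.mul_apply, one_mul]
    · have key : ∀ k, u i k * v k j = u i k * (1 : Matrix (Fin n) (Fin n) F) k j := fun k => by
        rw [hv k j fun h' => hj h'.2.2]
      simp_rw [key]
      rw [← Matrix.mul_apply, mul_one, hu i j h]
  · have key : ∀ k, u i k * v k j = (1 : Matrix (Fin n) (Fin n) F) i k * v k j := fun k => by
      rw [hu i k fun h' => hi h'.2.1]
    simp_rw [key]
    rw [← Matrix.mul_apply, one_mul, hv i j h]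

theorem isUnipotentOn_one {F : Type*} [Field F] (K : Finset (Fin n)) :
    IsUnipotentOn K (1 : Matrix (Fin n) (Fin n) F) :=
  (isUnipotentOn_iff K 1).mpr fun _ _ _ => rfl

/-- The group `U_K(q)`, as a subgroup of the general linear group. -/
def U (F : Type*) [Field F] [Finite F] (K : Finset (Fin n)) : Subgroup (GL (Fin n) F) where
  carrier := {u | IsUnipotentOn K (u : Matrix (Fin n) (Fin n) F)}
  mul_mem' := fun {u v} hu hv => by
    simpa only [Set.mem_ofPred_eq, Units.val_mul] using IsUnipotentOn.mul hu hv
  one_mem' := by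
    simpa only [Set.mem_ofPred_eq, Units.val_one] using isUnipotentOn_one K
  inv_mem' := fun {u} hu => by
    have hpow : ∀ m : ℕ, IsUnipotentOn K ((u ^ m : GL (Fin n) F) : Matrix (Fin n) (Fin n) F) := by
      intro m
      induction m with
      | zero => simpa using isUnipotentOn_one K
      | succ m ih =>
        rw [pow_succ, Units.val_mul]
        exact ih.mul hu
    have hinv : u⁻¹ = u ^ (orderOf u - 1) := by
      rw [inv_eq_iff_mul_eq_one, ← pow_succ', Nat.sub_add_cancel (orderOf_pos u),
        pow_orderOf_eq_one]
    rw [Set.mem_ofPred_eq, hinv]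
    exact hpow _

theorem U_mono (F : Type*) [Field F] [Finite F] {K L : Finset (Fin n)} (h : K ⊆ L) :
    U F K ≤ U F L :=
  fun _ hu => ⟨hu.1, hu.2.1, fun i j hij hL => hu.2.2 i j hij fun hK => hL ⟨h hK.1, h hK.2⟩⟩

noncomputable instance {F : Type*} [Field F] [Finite F] (K : Finset (Fin n)) :
    Fintype (U F K) :=
  Fintype.ofFinite _

/-- The restriction of a function on `U_L(q)` to `U_K(q)`. -/
def Res {F : Type*} [Field F] [Finite F] {K L : Finset (Fin n)} (h : K ⊆ L) (f : U F L → ℂ) :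
    U F K → ℂ :=
  fun u => f (Subgroup.inclusion (U_mono F h) u)

/-- The usual inner product of complex functions on a finite group. -/
noncomputable def charInner {G : Type*} [Group G] [Fintype G] (f g : G → ℂ) : ℂ :=
  (Fintype.card G : ℂ)⁻¹ * ∑ x : G, f x * conj (g x)

end Groups

section Supercharacters

variable {n : ℕ} {F : Type*} [Field F] [Fintype F]

/-- The sum of the elementary matrices of the arcs in `mu`, weighted by the labels. -/
def arcMatrix (mu : Multiset (Arc n F)) : Matrix (Fin n) (Fin n) F :=
  (mu.map fun α => Matrix.single α.left α.right α.label).sum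

/-- `u` lies in the superclass of `U_K(q)` indexed by the `q`-set partition `mu` of `K`, that is,
`x (u - 1) y` is the matrix of `mu` for some `x, y ∈ U_K(q)`. -/
def InSuperclass (K : Finset (Fin n)) (mu : Multiset (Arc n F)) (u : U F K) : Prop :=
  mu ∈ qSetPartitions F K ∧ ∃ x y : U F K,
    ((x : GL (Fin n) F) : Matrix (Fin n) (Fin n) F) *
      (((u : GL (Fin n) F) : Matrix (Fin n) (Fin n) F) - 1) *
      ((y : GL (Fin n) F) : Matrix (Fin n) (Fin n) F) = arcMatrix mu

/-- The `q`-set partition of `K` that indexes the superclass of `u` (mathematically, each element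
of `U_K(q)` lies in the superclass of exactly one `q`-set partition of `K`). -/
noncomputable def superclassIndex (K : Finset (Fin n)) (u : U F K) : Multiset (Arc n F) :=
  Classical.epsilon fun mu => InSuperclass K mu u

open Classical in
/-- The value of the supercharacter of `U_K(q)` attached to one arc `α = (i, l, a)` on the
superclass indexed by `mu`. -/
noncomputable def arcValue (ϑ : AddChar F ℂ) (K : Finset (Fin n)) (α : Arc n F)
    (mu : Multiset (Arc n F)) : ℂ :=
  if ∃ β ∈ mu, (β.left = α.left ∧ β.right < α.right) ∨ (α.left < β.left ∧ β.right = α.right) then 0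
  else
    (Fintype.card F : ℂ) ^ (K.filter fun j => α.left < j ∧ j < α.right).card /
      (Fintype.card F : ℂ) ^ (mu.filter fun β => α.left < β.left ∧ β.right < α.right).card *
      ϑ (α.label * wt mu α.left α.right)

/-- The character `χ^lam` of `U_K(q)` for a multiset `lam` of arcs on `K`: the product of the
characters of its arcs. For a `q`-set partition `lam` it is a supercharacter. -/
noncomputable def chi (ϑ : AddChar F ℂ) (K : Finset (Fin n)) (lam : Multiset (Arc n F)) :
    U F K → ℂ :=
  fun u => (lam.map fun α => arcValue ϑ K α (superclassIndex K u)).prod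

end Supercharacters

section Graph

/-! A multiset of arcs is enumerated by a list `A`; its elements, counted with multiplicity, are
the indices `x : Fin A.length`. The order of the list supplies the order `a₁, a₂, …` in which
parallel arcs are stacked. -/

variable {n : ℕ} {F : Type*} [Field F]

/-- The position of `x`, counted from `0`, among the arcs of `A` parallel to it. -/
def pos (A : List (Arc n F)) (x : Fin A.length) : ℕ :=
  (Finset.univ.filter fun y : Fin A.length =>
    y < x ∧ (A.get y).left = (A.get x).left ∧ (A.get y).right = (A.get x).right).card

/-- The height at which the right endpoint of `x` is stacked among the arcs parallel to `x`. -/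
def rightHeight (A : List (Arc n F)) (x : Fin A.length) : ℕ :=
  pos A x

/-- The height at which the left endpoint of `x` is stacked among the arcs parallel to `x`: the
order is the same as on the right, except that the top two arcs are exchanged if the labels of the
parallel arcs sum to zero (there are then at least two of them). -/
def leftHeight [DecidableEq F] (A : List (Arc n F)) (x : Fin A.length) : ℕ :=
  let m := mult (A : Multiset (Arc n F)) (A.get x).left (A.get x).right
  if wt (A : Multiset (Arc n F)) (A.get x).left (A.get x).right = 0 then
    Equiv.swap (m - 2) (m - 1) (pos A x)
  else pos A x

/-- The arc `x` starts below the arc `y`, which starts at the same node. -/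
def StartsBelow [DecidableEq F] (A : List (Arc n F)) (x y : Fin A.length) : Prop :=
  (A.get x).left = (A.get y).left ∧
    ((A.get x).right < (A.get y).right ∨
      ((A.get x).right = (A.get y).right ∧ leftHeight A x < leftHeight A y))

/-- The arc `x` ends below the arc `y`, which ends at the same node. -/
def EndsBelow (A : List (Arc n F)) (x y : Fin A.length) : Prop :=
  (A.get x).right = (A.get y).right ∧
    ((A.get y).left < (A.get x).left ∨
      ((A.get x).left = (A.get y).left ∧ rightHeight A x < rightHeight A y))

/-- The two labels of the endpoints of arcs. -/
inductive NodeLabel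
  /-- the label `•` -/
  | filled
  /-- the label `∘` -/
  | hollow

open Classical in
/-- The label of the left endpoint of the arc `x`. -/
noncomputable def labelL [DecidableEq F] (K : Finset (Fin n)) (A : List (Arc n F))
    (x : Fin A.length) : NodeLabel :=
  if (A.get x).left ∉ K ∨ ∃ y, StartsBelow A x y then .hollow else .filled

open Classical in
/-- The label of the right endpoint of the arc `x`. -/
noncomputable def labelR (K : Finset (Fin n)) (A : List (Arc n F)) (x : Fin A.length) :
    NodeLabel :=
  if (A.get x).right ∉ K ∨ ∃ y, EndsBelow A x y then .hollow else .filled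

/-- The arcs labelled `(•, •)`. -/
def VFilled [DecidableEq F] (K : Finset (Fin n)) (A : List (Arc n F)) : Set (Fin A.length) :=
  {x | (labelL K A x, labelR K A x) = (.filled, .filled)}

/-- The arcs labelled `(∘, ∘)`. -/
def VHollow [DecidableEq F] (K : Finset (Fin n)) (A : List (Arc n F)) : Set (Fin A.length) :=
  {x | (labelL K A x, labelR K A x) = (.hollow, .hollow)}

/-- The arc `y` is strictly nested in the arc `x`. -/
def Nested (A : List (Arc n F)) (x y : Fin A.length) : Prop :=
  (A.get x).left < (A.get y).left ∧ (A.get y).right < (A.get x).right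

/-- The bipartite graph `Γ_K`. An arc `x` labelled `(∘, ∘)` and an arc `y` labelled `(•, •)` are
joined by an edge if `y` is strictly nested in `x`. (The remaining arcs are kept as isolated
vertices, which take part in no matching.) -/
def Γ [DecidableEq F] (K : Finset (Fin n)) (A : List (Arc n F)) : SimpleGraph (Fin A.length) where
  Adj x y :=
    (x ∈ VHollow K A ∧ y ∈ VFilled K A ∧ Nested A x y) ∨
      (y ∈ VHollow K A ∧ x ∈ VFilled K A ∧ Nested A y x)
  symm := ⟨fun _ _ h => h.symm⟩
  loopless := ⟨fun _ h => h.elim (fun h => lt_irrefl _ h.2.2.1) (fun h => lt_irrefl _ h.2.2.1)⟩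

/-- A complete matching of `Γ_K` from the vertices `(•, •)` to the vertices `(∘, ∘)`: a matching
that covers all vertices labelled `(•, •)`. -/
def HasCompleteMatching [DecidableEq F] (K : Finset (Fin n)) (A : List (Arc n F)) : Prop :=
  ∃ M : (Γ K A).Subgraph, M.IsMatching ∧ VFilled K A ⊆ M.verts

end Graph

end Unipotent

/-! Up to a nonzero constant, the character of an arc `(i, l, a)` at `u` is the exponential sum of
`ϑ (a xᵀ (u - 1) y)` over the vectors `x` with leading entry `1` at `i` and the vectors `y` with
last nonzero entry `1` at `l` (`arcSum`). Unitriangular changes of `x` and `y` permute these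
vectors, so the sum is constant on superclasses and can be evaluated at a monomial representative
(`arcSum_arcMatrix`). The formula refers only to the matrix `u - 1`, which makes restriction from
`U_L` to `U_K` immediate.

Conjugation negates labels, so the inner product averages a product of such sums over the arcs of
`lam + bar mu`. Expanding it and summing over the additive group of the matrices `u - 1` gives a
nonzero multiple of the number of families `x p`, `y p` for which `∑ a p • x p ⊗ y p` vanishes
strictly above the diagonal of `K × K` (`charInner_ne_zero_iff`). The inner product is therefore
nonzero exactly when this system is solvable.

For the solvability, the prescribed end entries are allowed to be arbitrary scalars `ℓ p`, `ρ p`: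
zero is a hollow end, nonzero a filled one. Adding `c • x p'` to `x p` and correcting `y p'` by a
multiple of `y p` preserves the tensor sum (`Solvable.operation`). When two arcs share an endpoint,
such moves make the end of the lower one hollow. Two parallel arcs with both ends in `K` become a
filled and a hollow arc, unless their labels cancel, in which case each keeps one filled end; this
is the exchange in the stacking rule (`exists_solvable_iff_of_parallel`,
`exists_solvable_iff_stacked`).

Once filled left ends are distinct and filled right ends are distinct, a matching gives a solution
in which each filled arc is cancelled by its hollow partner. Conversely, dual bases turn a solution
into a triangular matrix with nonzero diagonal, indexed by a set of filled arcs, that factors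
through the space on the surrounding hollow arcs. Its rank gives Hall's condition
(`card_le_card_nested`, `solvable_iff_exists_injective`). -/

open scoped ComplexConjugate

namespace Unipotent

/-! ### Characters of single arcs as exponential sums -/

section ArcSums

variable {n : ℕ} {F : Type*} [Field F] [Fintype F]

/-- The vectors whose first nonzero coordinate is a `1` in position `i`. -/
def leadingVectors (F : Type*) [Field F] [Fintype F] (i : Fin n) : Finset (Fin n → F) :=
  Fintype.piFinset fun j => if j < i then {0} else if j = i then {1} else Finset.univ

/-- The vectors whose last nonzero coordinate is a `1` in position `l`. -/
def trailingVectors (F : Type*) [Field F] [Fintype F] (l : Fin n) : Finset (Fin n → F) :=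
  Fintype.piFinset fun k => if l < k then {0} else if k = l then {1} else Finset.univ

theorem mem_leadingVectors {i : Fin n} {x : Fin n → F} :
    x ∈ leadingVectors F i ↔ x i = 1 ∧ ∀ j < i, x j = 0 := by
  rw [leadingVectors, Fintype.mem_piFinset]
  constructor
  · intro h
    refine ⟨by simpa using h i, fun j hj => by simpa [hj] using h j⟩
  · rintro ⟨h1, h2⟩ j
    by_cases hj : j < i
    · simp [hj, h2 j hj]
    · by_cases hj' : j = i
      · subst hj'; simp [h1]
      · simp [hj, hj']

theorem mem_trailingVectors {l : Fin n} {y : Fin n → F} :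
    y ∈ trailingVectors F l ↔ y l = 1 ∧ ∀ k, l < k → y k = 0 := by
  rw [trailingVectors, Fintype.mem_piFinset]
  constructor
  · intro h
    refine ⟨by simpa using h l, fun j hj => by simpa [hj] using h j⟩
  · rintro ⟨h1, h2⟩ j
    by_cases hj : l < j
    · simp [hj, h2 j hj]
    · by_cases hj' : j = l
      · subst hj'; simp [h1]
      · simp [hj, hj']

/-- A multiple of the supercharacter of the full unipotent group attached to one arc, as a function
of the matrix `N = u - 1`. -/
noncomputable def arcSum (ϑ : AddChar F ℂ) (α : Arc n F) (N : Matrix (Fin n) (Fin n) F) : ℂ :=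
  ∑ x ∈ leadingVectors F α.left, ∑ y ∈ trailingVectors F α.right,
    ϑ (α.label * (x ⬝ᵥ N.mulVec y))

theorem conj_arcSum (ϑ : AddChar F ℂ) (α : Arc n F) (N : Matrix (Fin n) (Fin n) F) :
    conj (arcSum ϑ α N) = arcSum ϑ α.bar N := by
  simp only [arcSum, map_sum, Arc.bar, neg_mul]
  simp only [← AddChar.map_neg_eq_conj]

theorem vecMul_mem_leadingVectors {K : Finset (Fin n)} {g : Matrix (Fin n) (Fin n) F}
    (hg : IsUnipotentOn K g) {i : Fin n} {x : Fin n → F} (hx : x ∈ leadingVectors F i) :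
    Matrix.vecMul x g ∈ leadingVectors F i := by
  rw [mem_leadingVectors] at *
  simp only [Matrix.vecMul, dotProduct]
  constructor
  · rw [Finset.sum_eq_single i, hx.1, hg.1, mul_one]
    · intro j _ hj
      rcases lt_or_gt_of_ne hj with h | h
      · rw [hx.2 j h, zero_mul]
      · rw [hg.2.1 i j h, mul_zero]
    · simp
  · intro j hj
    refine Finset.sum_eq_zero fun k _ => ?_
    rcases lt_or_ge k i with h | h
    · rw [hx.2 k h, zero_mul]
    · rw [hg.2.1 j k (hj.trans_le h), mul_zero]

theorem mulVec_mem_trailingVectors {K : Finset (Fin n)} {g : Matrix (Fin n) (Fin n) F}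
    (hg : IsUnipotentOn K g) {l : Fin n} {y : Fin n → F} (hy : y ∈ trailingVectors F l) :
    Matrix.mulVec g y ∈ trailingVectors F l := by
  rw [mem_trailingVectors] at *
  simp only [Matrix.mulVec, dotProduct]
  constructor
  · rw [Finset.sum_eq_single l, hy.1, hg.1, mul_one]
    · intro j _ hj
      rcases lt_or_gt_of_ne hj with h | h
      · rw [hg.2.1 j l h, zero_mul]
      · rw [hy.2 j h, mul_zero]
    · simp
  · intro j hj
    refine Finset.sum_eq_zero fun k _ => ?_
    rcases lt_or_ge l k with h | h
    · rw [hy.2 k h, mul_zero]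
    · rw [hg.2.1 k j (h.trans_lt hj), zero_mul]

/-- The substitutions `x ↦ x g` and `y ↦ h y` permute the leading and the trailing vectors. This is
the reason why the sum is a function of the superclass. -/
theorem arcSum_mul_mul (ϑ : AddChar F ℂ) (α : Arc n F) {K : Finset (Fin n)} (g h : U F K)
    (N : Matrix (Fin n) (Fin n) F) :
    arcSum ϑ α (((g : GL (Fin n) F) : Matrix (Fin n) (Fin n) F) * N *
      ((h : GL (Fin n) F) : Matrix (Fin n) (Fin n) F)) = arcSum ϑ α N := by
  have e : ∀ g : U F K, ((g : GL (Fin n) F) : Matrix (Fin n) (Fin n) F) *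
      ((g⁻¹ : U F K) : GL (Fin n) F) = 1 := fun g => by
    rw [← Units.val_mul, ← Subgroup.coe_mul, mul_inv_cancel]; rfl
  have e' : ∀ g : U F K, (((g⁻¹ : U F K) : GL (Fin n) F) : Matrix (Fin n) (Fin n) F) *
      (g : GL (Fin n) F) = 1 := fun g => by
    rw [← Units.val_mul, ← Subgroup.coe_mul, inv_mul_cancel]; rfl
  unfold arcSum
  refine Finset.sum_bij' (fun x _ => Matrix.vecMul x ((g : GL (Fin n) F) : Matrix _ _ F))
    (fun x _ => Matrix.vecMul x (((g⁻¹ : U F K) : GL (Fin n) F) : Matrix _ _ F))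
    (fun x hx => vecMul_mem_leadingVectors g.2 hx)
    (fun x hx => vecMul_mem_leadingVectors (g⁻¹).2 hx)
    (fun x _ => by simp only [Matrix.vecMul_vecMul, e, Matrix.vecMul_one])
    (fun x _ => by simp only [Matrix.vecMul_vecMul, e', Matrix.vecMul_one]) fun x _ => ?_
  refine Finset.sum_bij' (fun y _ => Matrix.mulVec ((h : GL (Fin n) F) : Matrix _ _ F) y)
    (fun y _ => Matrix.mulVec (((h⁻¹ : U F K) : GL (Fin n) F) : Matrix _ _ F) y)
    (fun y hy => mulVec_mem_trailingVectors h.2 hy)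
    (fun y hy => mulVec_mem_trailingVectors (h⁻¹).2 hy)
    (fun y _ => by simp only [Matrix.mulVec_mulVec, e', Matrix.one_mulVec])
    (fun y _ => by simp only [Matrix.mulVec_mulVec, e, Matrix.one_mulVec]) fun y _ => ?_
  rw [← Matrix.mulVec_mulVec, ← Matrix.mulVec_mulVec, ← Matrix.dotProduct_mulVec]

omit [Fintype F] in
theorem arcMatrix_apply (nu : Multiset (Arc n F)) (j k : Fin n) :
    arcMatrix nu j k = wt nu j k := by
  classical
  unfold arcMatrix wt parallel
  induction nu using Multiset.induction_on with
  | empty => simp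
  | cons α s ih =>
    rw [Multiset.map_cons, Multiset.sum_cons, Matrix.add_apply, ih, Matrix.single_apply]
    by_cases h : α.left = j ∧ α.right = k
    · rw [Multiset.filter_cons_of_pos (p := fun α : Arc n F => α.left = j ∧ α.right = k) _ h, if_pos h, Multiset.map_cons, Multiset.sum_cons]
    · rw [Multiset.filter_cons_of_neg (p := fun α : Arc n F => α.left = j ∧ α.right = k) _ h, if_neg h, zero_add]

omit [Fintype F] in
theorem eq_of_left_eq {nu : Multiset (Arc n F)} (h : (nu.map Arc.left).Nodup) {β γ : Arc n F}
    (hβ : β ∈ nu) (hγ : γ ∈ nu) (e : β.left = γ.left) : β = γ :=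
  Multiset.inj_on_of_nodup_map h β hβ γ hγ e

omit [Fintype F] in
theorem wt_of_mem {nu : Multiset (Arc n F)} (h : (nu.map Arc.left).Nodup) {β : Arc n F}
    (hβ : β ∈ nu) : wt nu β.left β.right = β.label := by
  classical
  have : parallel nu β.left β.right = {β} := by
    have hn : (parallel nu β.left β.right).Nodup :=
      (Multiset.Nodup.of_map _ h).filter _
    refine (Multiset.Nodup.ext hn (Multiset.nodup_singleton _)).mpr fun γ => ?_
    rw [parallel, Multiset.mem_filter, Multiset.mem_singleton]
    exact ⟨fun hγ => eq_of_left_eq h hγ.1 hβ hγ.2.1, fun hγ => by subst hγ; exact ⟨hβ, rfl, rfl⟩⟩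
  rw [wt, this, Multiset.map_singleton, Multiset.sum_singleton]

omit [Fintype F] in
theorem exists_of_wt_ne_zero {nu : Multiset (Arc n F)} {j k : Fin n} (h : wt nu j k ≠ 0) :
    ∃ β ∈ nu, β.left = j ∧ β.right = k := by
  by_contra! hne
  refine h ?_
  have : parallel nu j k = 0 :=
    Multiset.filter_eq_nil.mpr fun β hβ h' => hne β hβ h'.1 h'.2
  rw [wt, this, Multiset.map_zero, Multiset.sum_zero]

omit [Fintype F] in
theorem addChar_sum {ι : Type*} (ϑ : AddChar F ℂ) (s : Finset ι) (f : ι → F) :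
    ϑ (∑ i ∈ s, f i) = ∏ i ∈ s, ϑ (f i) := by
  classical
  induction s using Finset.induction_on with
  | empty => simp
  | insert i s hi ih => rw [Finset.sum_insert hi, Finset.prod_insert hi, AddChar.map_add_eq_mul, ih]

theorem sum_addChar_mul {ϑ : AddChar F ℂ} (hϑ : ϑ ≠ 1) (w : F) [Decidable (w = 0)] :
    ∑ t : F, ϑ (w * t) = if w = 0 then (Fintype.card F : ℂ) else 0 := by
  classical
  have := AddChar.sum_mulShift w (AddChar.IsPrimitive.of_ne_one hϑ)
  simp_rw [mul_comm w]
  rw [this]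
  split_ifs <;> simp

open Classical in
-- The sum factors over the coordinates: each free coordinate gives `q` or `0` by orthogonality on
-- `F`, each fixed one a single value of `ϑ`.
theorem sum_trailingVectors {ϑ : AddChar F ℂ} (hϑ : ϑ ≠ 1) (l : Fin n) (w : Fin n → F) :
    ∑ y ∈ trailingVectors F l, ϑ (w ⬝ᵥ y) =
      if ∀ k < l, w k = 0 then
        (Fintype.card F : ℂ) ^ (Finset.univ.filter fun k : Fin n => k < l).card * ϑ (w l) else 0 := by
  have h1 : ∀ y : Fin n → F, ϑ (w ⬝ᵥ y) = ∏ k, ϑ (w k * y k) := fun y => by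
    rw [dotProduct, addChar_sum]
  simp_rw [h1]
  rw [trailingVectors, ← Finset.prod_univ_sum (f := fun k t => ϑ (w k * t))]
  have h2 : ∀ k : Fin n, (∑ t ∈ (if l < k then {0} else if k = l then {1} else Finset.univ : Finset F),
      ϑ (w k * t)) = (if k = l then ϑ (w l) else 1) *
        if k < l then (if w k = 0 then (Fintype.card F : ℂ) else 0) else 1 := by
    intro k
    rcases lt_trichotomy l k with h | rfl | h
    · simp [h, h.not_gt, h.ne']
    · simp
    · simp [h, h.not_gt, h.ne, sum_addChar_mul hϑ]
  simp_rw [h2]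
  rw [Finset.prod_mul_distrib, Finset.prod_ite_eq' Finset.univ l, if_pos (Finset.mem_univ _),
    ← Finset.prod_filter]
  split_ifs with h
  · rw [Finset.prod_congr rfl (g := fun _ => (Fintype.card F : ℂ)), Finset.prod_const, mul_comm]
    intro k hk
    rw [if_pos (h k (Finset.mem_filter.mp hk).2)]
  · push Not at h
    obtain ⟨k, hk, hw⟩ := h
    rw [Finset.prod_eq_zero (i := k) (by simp [hk]) (if_neg hw), mul_zero]

open Classical in
/-- The sum of `ϑ (w ⬝ᵥ x)` over the vectors `x` with leading entry `1` in position `i` that vanish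
on `J`. -/
theorem sum_leadingVectors {ϑ : AddChar F ℂ} (hϑ : ϑ ≠ 1) (i : Fin n) (w : Fin n → F)
    (J : Finset (Fin n)) (hJ : ∀ j ∈ J, w j = 0) :
    ∑ x ∈ leadingVectors F i, (if ∀ j ∈ J, x j = 0 then ϑ (w ⬝ᵥ x) else 0) =
      if i ∈ J ∨ ∃ j, i < j ∧ w j ≠ 0 then 0 else
        (Fintype.card F : ℂ) ^ (Finset.univ.filter fun j : Fin n => i < j ∧ j ∉ J).card * ϑ (w i) := by
  have h1 : ∀ x : Fin n → F, (if ∀ j ∈ J, x j = 0 then ϑ (w ⬝ᵥ x) else 0) =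
      ∏ j, if j ∈ J → x j = 0 then ϑ (w j * x j) else 0 := fun x => by
    split_ifs with h
    · rw [dotProduct, addChar_sum]
      exact Finset.prod_congr rfl fun j _ => (if_pos (h j)).symm
    · push Not at h
      obtain ⟨j, hj, hx⟩ := h
      rw [Finset.prod_eq_zero (Finset.mem_univ j)]
      rw [if_neg]
      exact fun h' => hx (h' hj)
  simp_rw [h1]
  rw [leadingVectors, ← Finset.prod_univ_sum (f := fun j t =>
    if j ∈ J → t = 0 then ϑ (w j * t) else 0)]
  have h2 : ∀ j : Fin n, (∑ t ∈ (if j < i then {0} else if j = i then {1} else Finset.univ : Finset F),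
      if j ∈ J → t = 0 then ϑ (w j * t) else 0) =
        (if j = i then (if i ∈ J then 0 else ϑ (w i)) else 1) *
        if i < j ∧ j ∉ J then (if w j = 0 then (Fintype.card F : ℂ) else 0) else 1 := by
    intro j
    rcases lt_trichotomy j i with h | rfl | h
    · simp [h, h.not_gt, h.ne]
    · by_cases hj : j ∈ J <;> simp [hj]
    · by_cases hj : j ∈ J
      · simp [h, h.not_gt, h.ne', hj]
      · simp [h, h.not_gt, h.ne', hj, sum_addChar_mul hϑ]
  simp_rw [h2]
  rw [Finset.prod_mul_distrib, Finset.prod_ite_eq' Finset.univ i, if_pos (Finset.mem_univ _),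
    ← Finset.prod_filter]
  by_cases hi : i ∈ J
  · simp [hi]
  rw [if_neg hi]
  split_ifs with h
  · obtain ⟨j, hj, hw⟩ := h.resolve_left hi
    rw [Finset.prod_eq_zero (i := j) _ (if_neg hw), mul_zero]
    exact Finset.mem_filter.mpr ⟨Finset.mem_univ _, hj, fun h' => hw (hJ j h')⟩
  · push Not at h
    rw [Finset.prod_congr rfl (g := fun _ => (Fintype.card F : ℂ)), Finset.prod_const, mul_comm]
    intro j hj
    rw [if_pos (h.2 j (Finset.mem_filter.mp hj).2.1)]

open Classical in
-- Summing over `y` first forces `x` to vanish on the set `J` of left endpoints of arcs ending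
-- before `α.right`. The sum over the remaining `x` is zero if `α.left ∈ J` or if an arc inside `α`
-- shares its right end. Otherwise each arc strictly nested in `α` removes one free coordinate of
-- `x`, hence one factor `q`.
theorem arcSum_arcMatrix {ϑ : AddChar F ℂ} (hϑ : ϑ ≠ 1) {K : Finset (Fin n)} (α : Arc n F)
    {nu : Multiset (Arc n F)} (hnu : nu ∈ qSetPartitions F K) :
    arcSum ϑ α (arcMatrix nu) =
      if ∃ β ∈ nu, (β.left = α.left ∧ β.right < α.right) ∨ (α.left < β.left ∧ β.right = α.right)
      then 0 else
      (Fintype.card F : ℂ) ^ ((Finset.univ.filter fun k : Fin n => k < α.right).card +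
        (Finset.univ.filter fun j : Fin n => α.left < j).card) /
      (Fintype.card F : ℂ) ^ (nu.filter fun β => α.left < β.left ∧ β.right < α.right).card *
      ϑ (α.label * wt nu α.left α.right) := by
  obtain ⟨-, hl, hr⟩ := hnu
  have hlabel := α.label_ne
  set J : Finset (Fin n) := Finset.univ.filter fun j => ∃ β ∈ nu, β.left = j ∧ β.right < α.right
    with hJdef
  -- A column of the monomial matrix has at most one nonzero entry, so each vanishing condition
  -- involves a single coordinate of `x`.
  have hcol : ∀ x : Fin n → F, (∀ k < α.right, (α.label • Matrix.vecMul x (arcMatrix nu)) k = 0) ↔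
      ∀ j ∈ J, x j = 0 := by
    intro x
    have key : ∀ β ∈ nu, Matrix.vecMul x (arcMatrix nu) β.right = x β.left * β.label := by
      intro β hβ
      rw [Matrix.vecMul, dotProduct, Finset.sum_eq_single β.left, arcMatrix_apply, wt_of_mem hl hβ]
      · intro j _ hj
        rw [arcMatrix_apply]
        by_contra h
        obtain ⟨γ, hγ, h1, h2⟩ := exists_of_wt_ne_zero (right_ne_zero_of_mul h)
        have := Multiset.inj_on_of_nodup_map hr γ hγ β hβ h2
        exact hj (this ▸ h1.symm)
      · simp
    constructor
    · intro h j hj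
      obtain ⟨β, hβ, rfl, h2⟩ := (Finset.mem_filter.mp hj).2
      have := h _ h2
      rw [Pi.smul_apply, key β hβ, smul_eq_mul] at this
      simpa [hlabel, β.label_ne] using this
    · intro h k hk
      rw [Pi.smul_apply]
      by_cases hk' : ∃ β ∈ nu, β.right = k
      · obtain ⟨β, hβ, rfl⟩ := hk'
        rw [key β hβ, h _ (Finset.mem_filter.mpr ⟨Finset.mem_univ _, β, hβ, rfl, hk⟩)]
        simp
      · rw [Matrix.vecMul, dotProduct, Finset.sum_eq_zero, smul_zero]
        intro j _
        rw [arcMatrix_apply]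
        by_contra h'
        obtain ⟨γ, hγ, h1, h2⟩ := exists_of_wt_ne_zero (right_ne_zero_of_mul h')
        exact hk' ⟨γ, hγ, h2⟩
  have h1 : arcSum ϑ α (arcMatrix nu) = ∑ x ∈ leadingVectors F α.left,
      (Fintype.card F : ℂ) ^ (Finset.univ.filter fun k : Fin n => k < α.right).card *
      (if ∀ j ∈ J, x j = 0 then
        ϑ ((fun j => α.label * wt nu j α.right) ⬝ᵥ x) else 0) := by
    refine Finset.sum_congr rfl fun x _ => ?_
    have : ∀ y : Fin n → F, α.label * (x ⬝ᵥ (arcMatrix nu).mulVec y) =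
        (α.label • Matrix.vecMul x (arcMatrix nu)) ⬝ᵥ y := fun y => by
      rw [Matrix.dotProduct_mulVec, smul_dotProduct, smul_eq_mul]
    simp_rw [this]
    rw [sum_trailingVectors hϑ]
    simp_rw [hcol x]
    have e : (α.label • Matrix.vecMul x (arcMatrix nu)) α.right =
        (fun j => α.label * wt nu j α.right) ⬝ᵥ x := by
      rw [Pi.smul_apply, smul_eq_mul, Matrix.vecMul, dotProduct, dotProduct, Finset.mul_sum]
      refine Finset.sum_congr rfl fun j _ => ?_
      rw [arcMatrix_apply]; ring
    rw [e]
    split_ifs <;> simp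
  rw [h1, ← Finset.mul_sum, sum_leadingVectors hϑ]
  · have hc : (α.left ∈ J ∨ ∃ j, α.left < j ∧ α.label * wt nu j α.right ≠ 0) ↔
        ∃ β ∈ nu, (β.left = α.left ∧ β.right < α.right) ∨
          (α.left < β.left ∧ β.right = α.right) := by
      constructor
      · rintro (h | ⟨j, hj, hw⟩)
        · obtain ⟨β, hβ, h1, h2⟩ := (Finset.mem_filter.mp h).2
          exact ⟨β, hβ, Or.inl ⟨h1, h2⟩⟩
        · obtain ⟨β, hβ, rfl, h2⟩ := exists_of_wt_ne_zero (right_ne_zero_of_mul hw)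
          exact ⟨β, hβ, Or.inr ⟨hj, h2⟩⟩
      · rintro ⟨β, hβ, ⟨h1, h2⟩ | ⟨h1, h2⟩⟩
        · exact Or.inl (Finset.mem_filter.mpr ⟨Finset.mem_univ _, β, hβ, h1, h2⟩)
        · refine Or.inr ⟨β.left, h1, mul_ne_zero hlabel ?_⟩
          rw [← h2, wt_of_mem hl hβ]
          exact β.label_ne
    simp_rw [hc]
    split_ifs with h
    · simp
    · have hq : (Fintype.card F : ℂ) ≠ 0 := Nat.cast_ne_zero.mpr Fintype.card_ne_zero
      have hcard : (Finset.univ.filter fun j : Fin n => α.left < j).card =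
          (Finset.univ.filter fun j : Fin n => α.left < j ∧ j ∉ J).card +
          (nu.filter fun β => α.left < β.left ∧ β.right < α.right).card := by
        have h2 : (nu.filter fun β => α.left < β.left ∧ β.right < α.right).card =
            (Finset.univ.filter fun j : Fin n => α.left < j ∧ j ∈ J).card := by
          have hn : ((nu.filter fun β => α.left < β.left ∧ β.right < α.right).map Arc.left).Nodup :=
            Multiset.nodup_of_le (Multiset.map_le_map (Multiset.filter_le _ _)) hl
          rw [← Multiset.card_map Arc.left, ← Multiset.toFinset_card_of_nodup hn]
          congr 1
          ext j
          simp only [Multiset.mem_toFinset, Multiset.mem_map, Multiset.mem_filter,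
            Finset.mem_filter, Finset.mem_univ, true_and, hJdef]
          constructor
          · rintro ⟨β, ⟨hβ, h1, h2⟩, rfl⟩
            exact ⟨h1, β, hβ, rfl, h2⟩
          · rintro ⟨h1, β, hβ, rfl, h2⟩
            exact ⟨β, ⟨hβ, h1, h2⟩, rfl⟩
        rw [h2, ← Finset.card_filter_add_card_filter_not (s := Finset.univ.filter
          fun j : Fin n => α.left < j) (fun j => j ∈ J), Finset.filter_filter,
          Finset.filter_filter, add_comm]
      rw [hcard, pow_add, pow_add]
      field_simp
  · intro j hj
    obtain ⟨β, hβ, rfl, h2⟩ := (Finset.mem_filter.mp hj).2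
    by_contra h
    obtain ⟨γ, hγ, h1, h3⟩ := exists_of_wt_ne_zero (right_ne_zero_of_mul h)
    have := eq_of_left_eq hl hγ hβ h1
    subst this
    exact h2.ne h3

/-- The two sides differ only in normalising powers of `q`, which depend on `K` and `α` but not on
the superclass. -/
theorem exists_arcValue_eq_mul_arcSum {ϑ : AddChar F ℂ} (hϑ : ϑ ≠ 1) (K : Finset (Fin n))
    (α : Arc n F) : ∃ c : ℂ, c ≠ 0 ∧ ∀ {L : Finset (Fin n)}, ∀ nu ∈ qSetPartitions F L,
      arcValue ϑ K α nu = c * arcSum ϑ α (arcMatrix nu) := by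
  classical
  have hq : (Fintype.card F : ℂ) ≠ 0 := Nat.cast_ne_zero.mpr Fintype.card_ne_zero
  refine ⟨(Fintype.card F : ℂ) ^ (K.filter fun j => α.left < j ∧ j < α.right).card /
    (Fintype.card F : ℂ) ^ ((Finset.univ.filter fun k : Fin n => k < α.right).card +
        (Finset.univ.filter fun j : Fin n => α.left < j).card),
    div_ne_zero (pow_ne_zero _ hq) (pow_ne_zero _ hq), fun nu hnu => ?_⟩
  rw [arcSum_arcMatrix hϑ α hnu, arcValue]
  split_ifs with h
  · simp
  · field_simp

end ArcSums
-- Superclass representatives by elimination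
section Reduction

variable {n : ℕ} {F : Type*} [Field F]

theorem IsUnipotentOn.det_eq_one {K : Finset (Fin n)} {m : Matrix (Fin n) (Fin n) F}
    (hm : IsUnipotentOn K m) : m.det = 1 := by
  rw [Matrix.det_of_isUpperTriangular]
  · exact Finset.prod_eq_one fun i _ => hm.1 i
  · exact fun i j hij => hm.2.1 j i hij

theorem IsUnipotentOn.exists_coe_eq [Finite F] {K : Finset (Fin n)} {m : Matrix (Fin n) (Fin n) F}
    (hm : IsUnipotentOn K m) : ∃ u : U F K, ((u : GL (Fin n) F) : Matrix (Fin n) (Fin n) F) = m :=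
  ⟨⟨Matrix.GeneralLinearGroup.mkOfDetNeZero m (by rw [hm.det_eq_one]; exact one_ne_zero), hm⟩, rfl⟩

/-- The entries of `N` vanish outside of the positions `(j, k)` with `j < k` in `K`. -/
def IsNilpotentOn (K : Finset (Fin n)) (N : Matrix (Fin n) (Fin n) F) : Prop :=
  ∀ j k, ¬ (j < k ∧ j ∈ K ∧ k ∈ K) → N j k = 0

theorem isNilpotentOn_sub_one_iff {K : Finset (Fin n)} {m : Matrix (Fin n) (Fin n) F} :
    IsNilpotentOn K (m - 1) ↔ IsUnipotentOn K m := by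
  rw [isUnipotentOn_iff, IsNilpotentOn]
  simp only [Matrix.sub_apply, sub_eq_zero]

theorem IsNilpotentOn.isUnipotentOn_one_add {K : Finset (Fin n)} {N : Matrix (Fin n) (Fin n) F}
    (hN : IsNilpotentOn K N) : IsUnipotentOn K (1 + N) := by
  rw [← isNilpotentOn_sub_one_iff, add_sub_cancel_left]
  exact hN

/-- Both `h` and `(1 + N) * h = h + N * h` are unipotent on `K`; their difference is `N * h`. -/
theorem IsNilpotentOn.mul_right {K : Finset (Fin n)} {N h : Matrix (Fin n) (Fin n) F}
    (hN : IsNilpotentOn K N) (hh : IsUnipotentOn K h) : IsNilpotentOn K (N * h) := by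
  intro j k hjk
  have h1 := (isUnipotentOn_iff K _).mp (hN.isUnipotentOn_one_add.mul hh) j k hjk
  have h2 := (isUnipotentOn_iff K _).mp hh j k hjk
  rw [add_mul, one_mul, Matrix.add_apply, h2] at h1
  simpa using h1

theorem IsNilpotentOn.mul_left {K : Finset (Fin n)} {N h : Matrix (Fin n) (Fin n) F}
    (hN : IsNilpotentOn K N) (hh : IsUnipotentOn K h) : IsNilpotentOn K (h * N) := by
  intro j k hjk
  have h1 := (isUnipotentOn_iff K _).mp (hh.mul hN.isUnipotentOn_one_add) j k hjk
  have h2 := (isUnipotentOn_iff K _).mp hh j k hjk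
  rw [mul_add, mul_one, Matrix.add_apply, h2] at h1
  simpa using h1

/-- Every row and every column of `N` has at most one nonzero entry among the first `k` columns. -/
def IsPartialMonomial (k : ℕ) (N : Matrix (Fin n) (Fin n) F) : Prop :=
  (∀ b : Fin n, (b : ℕ) < k → ∀ j j', N j b ≠ 0 → N j' b ≠ 0 → j = j') ∧
    ∀ b b' : Fin n, (b : ℕ) < k → (b' : ℕ) < k → ∀ j, N j b ≠ 0 → N j b' ≠ 0 → b = b'

/-- Column operations clear the entries of the column `κ` in the rows of the previous pivots. -/
theorem exists_column_clearing {K : Finset (Fin n)} {N : Matrix (Fin n) (Fin n) F}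
    (hN : IsNilpotentOn K N) (κ : Fin n) (hk : IsPartialMonomial κ N) :
    ∃ h : Matrix (Fin n) (Fin n) F, IsUnipotentOn K h ∧
      (∀ j b, b ≠ κ → (N * h) j b = N j b) ∧
      ∀ j b, b < κ → N j b ≠ 0 → (N * h) j κ = 0 := by
  classical
  -- Since `0⁻¹ = 0` and column `b` has at most one nonzero entry, the sum selects the pivot row of
  -- `b` and is the usual elimination coefficient.
  set c : Fin n → F := fun b => if b < κ then -∑ j, N j κ * (N j b)⁻¹ else 0 with hc
  refine ⟨1 + Matrix.of fun a b => if b = κ then c a else 0, ?_, ?_, ?_⟩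
  · refine IsNilpotentOn.isUnipotentOn_one_add fun a b hab => ?_
    rw [Matrix.of_apply]
    split_ifs with hb
    · subst hb
      simp only [hc]
      split_ifs with ha
      · rw [Finset.sum_eq_zero, neg_zero]
        intro j _
        by_contra hne
        have h1 : N j b ≠ 0 := left_ne_zero_of_mul hne
        have h2 : N j a ≠ 0 := fun h0 =>
          right_ne_zero_of_mul hne (by rw [h0, inv_zero])
        refine hab ⟨ha, ?_, ?_⟩
        · by_contra h; exact h2 (hN j a fun h' => h h'.2.2)
        · by_contra h; exact h1 (hN j b fun h' => h h'.2.2)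
      · rfl
    · rfl
  · intro j b hb
    rw [mul_add, mul_one, Matrix.add_apply, Matrix.mul_apply]
    simp [hb]
  · intro j b hb hne
    rw [mul_add, mul_one, Matrix.add_apply, Matrix.mul_apply, Finset.sum_eq_single b]
    · simp only [Matrix.of_apply, if_true, hc, if_pos hb]
      rw [Finset.sum_eq_single j]
      · field_simp; ring
      · intro j' _ hj'
        have : N j' b = 0 := by
          by_contra h
          exact hj' (hk.1 b hb j' j h hne)
        rw [this, inv_zero, mul_zero]
      · simp
    · intro b' _ hb'
      simp only [Matrix.of_apply, if_true, hc]
      split_ifs with h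
      · have : N j b' = 0 := by
          by_contra h'
          exact hb' (hk.2 b' b h hb j h' hne)
        rw [this, zero_mul]
      · rw [mul_zero]
    · simp

/-- Row operations clear the entries of the column `κ` above its lowest nonzero entry. -/
theorem exists_row_clearing {K : Finset (Fin n)} {N : Matrix (Fin n) (Fin n) F}
    (hN : IsNilpotentOn K N) (κ : Fin n)
    (hz : ∀ j b, b < κ → N j b ≠ 0 → N j κ = 0) :
    ∃ g : Matrix (Fin n) (Fin n) F, IsUnipotentOn K g ∧
      (∀ j b, b < κ → (g * N) j b = N j b) ∧
      (∀ j j', (g * N) j κ ≠ 0 → (g * N) j' κ ≠ 0 → j = j') ∧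
      ∀ j b, b < κ → N j b ≠ 0 → (g * N) j κ = 0 := by
  classical
  by_cases hcol : ∃ j, N j κ ≠ 0
  · have hne : (Finset.univ.filter fun j => N j κ ≠ 0).Nonempty := by
      obtain ⟨j, hj⟩ := hcol
      exact ⟨j, by simpa using hj⟩
    obtain ⟨p, hp, hmax⟩ := Finset.exists_max_image _ id hne
    replace hp : N p κ ≠ 0 := (Finset.mem_filter.mp hp).2
    replace hmax : ∀ j, p < j → N j κ = 0 := fun j hj => by
      by_contra h
      exact (hmax j (by simpa using h)).not_gt hj
    -- Only rows above the lowest nonzero entry `p` are changed, which keeps the operation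
    -- unitriangular. Row `p` vanishes in the earlier columns by `hz`, so these are not disturbed.
    set d : Fin n → F := fun j => if j < p then -(N j κ * (N p κ)⁻¹) else 0 with hd
    have happ : ∀ j b, ((1 + Matrix.of fun a b => if b = p then d a else 0) * N) j b =
        N j b + d j * N p b := fun j b => by
      rw [add_mul, one_mul, Matrix.add_apply, Matrix.mul_apply]
      simp
    have hpb : ∀ b, b < κ → N p b = 0 := fun b hb => by
      by_contra h
      exact hp (hz p b hb h)
    have hκ : ∀ j, j ≠ p → N j κ + d j * N p κ = 0 := fun j hj => by
      simp only [hd]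
      rcases lt_or_gt_of_ne hj with h | h
      · rw [if_pos h]; field_simp; ring
      · rw [if_neg h.not_gt, hmax j h]; simp
    refine ⟨1 + Matrix.of fun a b => if b = p then d a else 0, ?_, ?_, ?_, ?_⟩
    · refine IsNilpotentOn.isUnipotentOn_one_add fun a b hab => ?_
      rw [Matrix.of_apply]
      split_ifs with hb
      · subst hb
        simp only [hd]
        split_ifs with ha
        · rw [hN a κ, zero_mul, neg_zero]
          rintro ⟨h1, h2, h3⟩
          refine hab ⟨ha, h2, ?_⟩
          by_contra h
          exact hp (hN b κ fun h' => h h'.2.1)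
        · rfl
      · rfl
    · intro j b hb
      rw [happ, hpb b hb, mul_zero, add_zero]
    · intro j j' h1 h2
      rw [happ] at h1 h2
      have e1 : j = p := by by_contra h; exact h1 (hκ j h)
      have e2 : j' = p := by by_contra h; exact h2 (hκ j' h)
      rw [e1, e2]
    · intro j b hb hne
      rw [happ]
      refine hκ j ?_
      rintro rfl
      exact hne (hpb b hb)
  · push Not at hcol
    refine ⟨1, isUnipotentOn_one K, ?_, ?_, ?_⟩ <;> simp [hcol]

theorem exists_isPartialMonomial [Finite F] {K : Finset (Fin n)} {N : Matrix (Fin n) (Fin n) F}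
    (hN : IsNilpotentOn K N) (k : ℕ) (hk : k ≤ n) : ∃ g h : U F K,
      IsPartialMonomial k (((g : GL (Fin n) F) : Matrix (Fin n) (Fin n) F) * N *
        ((h : GL (Fin n) F) : Matrix (Fin n) (Fin n) F)) := by
  induction k with
  | zero => exact ⟨1, 1, fun b hb => absurd hb (Nat.not_lt_zero _),
      fun b _ hb => absurd hb (Nat.not_lt_zero _)⟩
  | succ k ih =>
    obtain ⟨g, h, hm⟩ := ih (by omega)
    set κ : Fin n := ⟨k, by omega⟩
    set M := ((g : GL (Fin n) F) : Matrix (Fin n) (Fin n) F) * N *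
        ((h : GL (Fin n) F) : Matrix (Fin n) (Fin n) F) with hMdef
    have hM : IsNilpotentOn K M := (hN.mul_left g.2).mul_right h.2
    obtain ⟨h', hh', hc1, hc2⟩ := exists_column_clearing hM κ hm
    obtain ⟨g', hg', hr1, hr2, hr3⟩ := exists_row_clearing (hM.mul_right hh') κ
      fun j b hb hne => hc2 j b hb (by rwa [hc1 j b hb.ne] at hne)
    obtain ⟨v, rfl⟩ := hh'.exists_coe_eq
    obtain ⟨w, rfl⟩ := hg'.exists_coe_eq
    refine ⟨w * g, h * v, ?_⟩
    have e : (((w * g : U F K) : GL (Fin n) F) : Matrix (Fin n) (Fin n) F) * N *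
        (((h * v : U F K) : GL (Fin n) F) : Matrix (Fin n) (Fin n) F) =
        ((w : GL (Fin n) F) : Matrix (Fin n) (Fin n) F) *
          (M * ((v : GL (Fin n) F) : Matrix (Fin n) (Fin n) F)) := by
      simp only [hMdef, Subgroup.coe_mul, Units.val_mul, Matrix.mul_assoc]
    rw [e]
    set M' := ((w : GL (Fin n) F) : Matrix (Fin n) (Fin n) F) *
          (M * ((v : GL (Fin n) F) : Matrix (Fin n) (Fin n) F))
    have hold : ∀ j b, b < κ → M' j b = M j b := fun j b hb => by
      rw [hr1 j b hb, hc1 j b hb.ne]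
    have hcases : ∀ b : Fin n, (b : ℕ) < k + 1 → b < κ ∨ b = κ := fun b hb => by
      rcases Nat.lt_succ_iff_lt_or_eq.mp hb with h | h
      · exact Or.inl h
      · exact Or.inr (Fin.ext h)
    have hcross : ∀ j b, b < κ → M' j b ≠ 0 → M' j κ = 0 := fun j b hb hne =>
      hr3 j b hb (by rwa [hc1 j b hb.ne, ← hold j b hb])
    constructor
    · intro b hb j j' h1 h2
      rcases hcases b hb with hb | rfl
      · rw [hold _ _ hb] at h1 h2
        exact hm.1 b hb j j' h1 h2
      · exact hr2 j j' h1 h2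
    · intro b b' hb hb' j h1 h2
      rcases hcases b hb with hb | rfl
      · rcases hcases b' hb' with hb' | rfl
        · rw [hold _ _ hb] at h1
          rw [hold _ _ hb'] at h2
          exact hm.2 b b' hb hb' j h1 h2
        · exact absurd (hcross j b hb h1) h2
      · rcases hcases b' hb' with hb' | rfl
        · exact absurd (hcross j b' hb' h2) h1
        · rfl

theorem exists_arcMatrix_eq {K : Finset (Fin n)} {N : Matrix (Fin n) (Fin n) F}
    (hN : IsNilpotentOn K N) (hm : IsPartialMonomial n N) :
    ∃ nu ∈ qSetPartitions F K, arcMatrix nu = N := by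
  classical
  have hmem : ∀ p : Fin n × Fin n, N p.1 p.2 ≠ 0 → p.1 < p.2 ∧ p.1 ∈ K ∧ p.2 ∈ K := fun p hp => by
    by_contra h
    exact hp (hN _ _ h)
  let S : Finset (Fin n × Fin n) := Finset.univ.filter fun p => N p.1 p.2 ≠ 0
  have hS : ∀ p : S, N p.1.1 p.1.2 ≠ 0 := fun p => (Finset.mem_filter.mp p.2).2
  let f : S → Arc n F := fun p => ⟨p.1.1, p.1.2, (hmem _ (hS p)).1, N p.1.1 p.1.2, hS p⟩
  refine ⟨S.attach.val.map f, ⟨?_, ?_, ?_⟩, ?_⟩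
  · intro α hα
    obtain ⟨p, -, rfl⟩ := Multiset.mem_map.mp hα
    exact (hmem _ (hS p)).2
  · rw [Multiset.map_map]
    refine Multiset.Nodup.map_on ?_ S.attach.nodup
    rintro ⟨⟨a, b⟩, hp⟩ - ⟨⟨a', b'⟩, hq⟩ - (h : a = a')
    subst h
    have := hm.2 b b' b.2 b'.2 a (hS ⟨_, hp⟩) (hS ⟨_, hq⟩)
    subst this
    rfl
  · rw [Multiset.map_map]
    refine Multiset.Nodup.map_on ?_ S.attach.nodup
    rintro ⟨⟨a, b⟩, hp⟩ - ⟨⟨a', b'⟩, hq⟩ - (h : b = b')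
    subst h
    have := hm.1 b b.2 a a' (hS ⟨_, hp⟩) (hS ⟨_, hq⟩)
    subst this
    rfl
  · rw [arcMatrix, Multiset.map_map]
    change ∑ p ∈ S.attach, Matrix.single p.1.1 p.1.2 (N p.1.1 p.1.2) = N
    rw [Finset.sum_attach S fun p => Matrix.single p.1 p.2 (N p.1 p.2),
      Finset.sum_filter_of_ne, Fintype.sum_prod_type]
    · exact (Matrix.matrix_eq_sum_single N).symm
    · intro p _ hp h
      rw [h] at hp
      exact hp (by simp)

variable [Fintype F]

theorem exists_inSuperclass (K : Finset (Fin n)) (u : U F K) : ∃ mu, InSuperclass K mu u := by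
  have hN : IsNilpotentOn K (((u : GL (Fin n) F) : Matrix (Fin n) (Fin n) F) - 1) :=
    isNilpotentOn_sub_one_iff.mpr u.2
  obtain ⟨g, h, hm⟩ := exists_isPartialMonomial hN n le_rfl
  obtain ⟨nu, hnu, e⟩ := exists_arcMatrix_eq ((hN.mul_left g.2).mul_right h.2) hm
  exact ⟨nu, hnu, g, h, e.symm⟩

theorem inSuperclass_superclassIndex (K : Finset (Fin n)) (u : U F K) :
    InSuperclass K (superclassIndex K u) u :=
  Classical.epsilon_spec (exists_inSuperclass K u)

/-- Up to nonzero constants, the characters of arcs are given by `arcSum`. -/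
theorem exists_chi_eq {ϑ : AddChar F ℂ} (hϑ : ϑ ≠ 1) (K : Finset (Fin n))
    (lam : Multiset (Arc n F)) : ∃ c : ℂ, c ≠ 0 ∧ ∀ u : U F K, chi ϑ K lam u =
      c * (lam.map fun α =>
        arcSum ϑ α (((u : GL (Fin n) F) : Matrix (Fin n) (Fin n) F) - 1)).prod := by
  choose c hc h using exists_arcValue_eq_mul_arcSum hϑ K
  refine ⟨(lam.map c).prod, ?_, fun u => ?_⟩
  · rw [Ne, Multiset.prod_eq_zero_iff, Multiset.mem_map]
    rintro ⟨α, -, h0⟩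
    exact hc α h0
  -- Any representative of the superclass would do: bi-invariance carries the value back to `u - 1`,
  -- so uniqueness of the index plays no role.
  · obtain ⟨hnu, x, y, e⟩ := inSuperclass_superclassIndex K u
    rw [chi, ← Multiset.prod_map_mul]
    congr 1
    refine Multiset.map_congr rfl fun α _ => ?_
    rw [h α _ hnu, ← e, arcSum_mul_mul]

end Reduction
-- The inner product as a count of solutions
section InnerProduct

variable {n : ℕ} {F : Type*} [Field F]

/-- The additive group of the matrices `u - 1` with `u` in `U_K`. -/
def nilpotentOn (F : Type*) [Field F] (K : Finset (Fin n)) :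
    AddSubgroup (Matrix (Fin n) (Fin n) F) where
  carrier := {N | IsNilpotentOn K N}
  add_mem' := fun {M N} hM hN j k h => by rw [Matrix.add_apply, hM j k h, hN j k h, add_zero]
  zero_mem' := fun _ _ _ => rfl
  neg_mem' := fun {N} hN j k h => by rw [Matrix.neg_apply, hN j k h, neg_zero]

/-- The additive character of the group of nilpotent matrices attached to a coefficient matrix. -/
def matrixAddChar (ϑ : AddChar F ℂ) (K : Finset (Fin n)) (m : Fin n → Fin n → F) :
    AddChar (nilpotentOn F K) ℂ where
  toFun N := ϑ (∑ j, ∑ k, m j k * N.1 j k)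
  map_zero_eq_one' := by simp
  map_add_eq_mul' M N := by
    rw [← AddChar.map_add_eq_mul]
    simp [mul_add, Finset.sum_add_distrib]

/-- A nonzero coefficient at an admissible position can be detected on the multiples of one
elementary matrix, where the character takes all values of `ϑ`. -/
theorem matrixAddChar_eq_zero_iff {ϑ : AddChar F ℂ} (hϑ : ϑ ≠ 1) (K : Finset (Fin n))
    (m : Fin n → Fin n → F) :
    matrixAddChar ϑ K m = 0 ↔ ∀ j ∈ K, ∀ k ∈ K, j < k → m j k = 0 := by
  classical
  constructor
  · intro h j hj k hk hjk
    by_contra hm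
    refine hϑ (DFunLike.ext _ _ fun t => ?_)
    have hN : IsNilpotentOn K (Matrix.single j k ((m j k)⁻¹ * t)) := fun a b hab => by
      rw [Matrix.single_apply, if_neg]
      rintro ⟨rfl, rfl⟩
      exact hab ⟨hjk, hj, hk⟩
    have := DFunLike.congr_fun h (⟨_, hN⟩ : nilpotentOn F K)
    change ϑ (∑ a, ∑ b, m a b * Matrix.single j k ((m j k)⁻¹ * t) a b) = 1 at this
    rw [Finset.sum_eq_single j, Finset.sum_eq_single k, Matrix.single_apply_same] at this
    · rw [← mul_assoc, mul_inv_cancel₀ hm, one_mul] at this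
      simpa using this
    · intro b _ hb
      rw [Matrix.single_apply, if_neg (fun h => hb h.2.symm), mul_zero]
    · simp
    · intro a _ ha
      refine Finset.sum_eq_zero fun b _ => ?_
      rw [Matrix.single_apply, if_neg (fun h => ha h.1.symm), mul_zero]
    · simp
  · intro h
    refine DFunLike.ext _ _ fun N => ?_
    change ϑ (∑ a, ∑ b, m a b * N.1 a b) = 1
    rw [Finset.sum_eq_zero, AddChar.map_zero_eq_one]
    refine fun a _ => Finset.sum_eq_zero fun b _ => ?_
    by_cases hab : a < b ∧ a ∈ K ∧ b ∈ K
    · rw [h a hab.2.1 b hab.2.2 hab.1, zero_mul]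
    · rw [N.2 a b hab, mul_zero]

/-- The matrix `u - 1` determines `u`. -/
noncomputable def subOneEquiv [Finite F] (K : Finset (Fin n)) : U F K ≃ nilpotentOn F K :=
  Equiv.ofBijective (fun u => ⟨((u : GL (Fin n) F) : Matrix (Fin n) (Fin n) F) - 1,
    isNilpotentOn_sub_one_iff.mpr u.2⟩) <| by
    constructor
    · intro u v h
      exact Subtype.ext (Units.ext (sub_left_injective (congrArg Subtype.val h)))
    · rintro ⟨N, hN⟩
      obtain ⟨u, hu⟩ := (IsNilpotentOn.isUnipotentOn_one_add hN).exists_coe_eq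
      exact ⟨u, Subtype.ext (by simp [hu])⟩

open Classical in
-- The bijection `u ↦ u - 1` turns this into orthogonality of characters of a finite abelian group.
theorem sum_addChar_sub_one [Fintype F] {ϑ : AddChar F ℂ} (hϑ : ϑ ≠ 1) (K : Finset (Fin n))
    (m : Fin n → Fin n → F) :
    ∑ u : U F K, ϑ (∑ j, ∑ k, m j k *
      (((u : GL (Fin n) F) : Matrix (Fin n) (Fin n) F) - 1) j k) =
      if ∀ j ∈ K, ∀ k ∈ K, j < k → m j k = 0 then (Fintype.card (U F K) : ℂ) else 0 := by
  rw [← Fintype.sum_equiv (subOneEquiv K).symm (matrixAddChar ϑ K m), AddChar.sum_eq_ite,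
    Fintype.card_congr (subOneEquiv (F := F) K)]
  · simp_rw [matrixAddChar_eq_zero_iff hϑ]
  · intro N
    obtain ⟨u, rfl⟩ := (subOneEquiv K).surjective N
    rw [Equiv.symm_apply_apply]
    rfl

variable [Fintype F]

theorem prod_arcSum (ϑ : AddChar F ℂ) {ι : Type*} [Fintype ι] [DecidableEq ι] (β : ι → Arc n F)
    (N : Matrix (Fin n) (Fin n) F) :
    ∏ p, arcSum ϑ (β p) N =
      ∑ z ∈ Fintype.piFinset fun p =>
        leadingVectors F (β p).left ×ˢ trailingVectors F (β p).right,
        ϑ (∑ j, ∑ k, (∑ p, (β p).label * (z p).1 j * (z p).2 k) * N j k) := by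
  have hprod : ∀ p, arcSum ϑ (β p) N = ∑ z ∈ leadingVectors F (β p).left ×ˢ
      trailingVectors F (β p).right, ϑ ((β p).label * (z.1 ⬝ᵥ N.mulVec z.2)) :=
    fun p => (Finset.sum_product' _ _ _).symm
  simp_rw [hprod]
  rw [Finset.prod_univ_sum]
  refine Finset.sum_congr rfl fun z _ => ?_
  rw [← addChar_sum]
  congr 1
  simp_rw [Finset.sum_mul]
  have : ∀ p, (β p).label * ((z p).1 ⬝ᵥ N.mulVec (z p).2) =
      ∑ j, ∑ k, (β p).label * (z p).1 j * (z p).2 k * N j k := fun p => by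
    simp_rw [dotProduct, Matrix.mulVec, dotProduct, Finset.mul_sum]
    exact Finset.sum_congr rfl fun j _ => Finset.sum_congr rfl fun k _ => by ring
  simp_rw [this]
  exact Finset.sum_comm.trans (Finset.sum_congr rfl fun j _ => Finset.sum_comm)

/-- The inner product counts the solutions of a system of equations, up to a nonzero constant. -/
theorem charInner_ne_zero_iff {ϑ : AddChar F ℂ} (hϑ : ϑ ≠ 1) {K L : Finset (Fin n)} (hKL : K ⊆ L)
    (lam mu : Multiset (Arc n F)) (A : List (Arc n F))
    (hA : (A : Multiset (Arc n F)) = lam + bar mu) :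
    charInner (Res hKL (chi ϑ L lam)) (chi ϑ K mu) ≠ 0 ↔
      ∃ x y : Fin A.length → Fin n → F,
        (∀ p, x p ∈ leadingVectors F (A.get p).left) ∧
        (∀ p, y p ∈ trailingVectors F (A.get p).right) ∧
        ∀ j ∈ K, ∀ k ∈ K, j < k → ∑ p, (A.get p).label * x p j * y p k = 0 := by
  classical
  obtain ⟨c, hc, hlam⟩ := exists_chi_eq hϑ L lam
  obtain ⟨d, hd, hmu⟩ := exists_chi_eq hϑ K mu
  have hterm : ∀ u : U F K, Res hKL (chi ϑ L lam) u * conj (chi ϑ K mu u) =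
      c * conj d * ∏ p, arcSum ϑ (A.get p)
        (((u : GL (Fin n) F) : Matrix (Fin n) (Fin n) F) - 1) := by
    intro u
    set N := ((u : GL (Fin n) F) : Matrix (Fin n) (Fin n) F) - 1 with hN
    have h1 : Res hKL (chi ϑ L lam) u = c * (lam.map fun α => arcSum ϑ α N).prod := hlam _
    have h2 : ∏ p, arcSum ϑ (A.get p) N =
        ((A : Multiset (Arc n F)).map fun α => arcSum ϑ α N).prod := by
      rw [Multiset.map_coe, Multiset.prod_coe, ← List.prod_ofFn]
      congr 1
      conv_rhs => rw [← List.ofFn_get A, List.map_ofFn]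
      rfl
    rw [h1, h2, hA, Multiset.map_add, Multiset.prod_add, hmu u, map_mul, map_multiset_prod, bar,
      Multiset.map_map, Multiset.map_map]
    simp only [Function.comp_def, conj_arcSum]
    ring
  have hq : (Fintype.card (U F K) : ℂ) ≠ 0 := Nat.cast_ne_zero.mpr Fintype.card_ne_zero
  replace hd : conj d ≠ 0 := (map_ne_zero _).mpr hd
  rw [charInner]
  simp_rw [hterm, prod_arcSum]
  rw [← Finset.mul_sum, Finset.sum_comm]
  rw [Finset.sum_congr rfl fun z _ => sum_addChar_sub_one hϑ K fun j k =>
    ∑ p, (A.get p).label * (z p).1 j * (z p).2 k]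
  -- Every solution contributes the same positive number `|U_K|`, so nothing can cancel and the
  -- total is nonzero as soon as one solution exists.
  rw [← Finset.sum_filter, Finset.sum_const, nsmul_eq_mul]
  simp only [ne_eq, mul_eq_zero (M₀ := ℂ), inv_eq_zero, hq, hc, hd, false_or, or_false,
    Nat.cast_eq_zero, Finset.card_eq_zero]
  rw [← Ne, ← Finset.nonempty_iff_ne_empty]
  constructor
  · rintro ⟨z, hz⟩
    rw [Finset.mem_filter, Fintype.mem_piFinset] at hz
    exact ⟨fun p => (z p).1, fun p => (z p).2, fun p => (Finset.mem_product.mp (hz.1 p)).1,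
      fun p => (Finset.mem_product.mp (hz.1 p)).2, hz.2⟩
  · rintro ⟨x, y, hx, hy, h⟩
    refine ⟨fun p => (x p, y p), ?_⟩
    rw [Finset.mem_filter, Fintype.mem_piFinset]
    exact ⟨fun p => Finset.mem_product.mpr ⟨hx p, hy p⟩, h⟩

end InnerProduct
-- Solvable systems and Hall's condition
section Systems

variable {n : ℕ} {F : Type*} [Field F] {ι : Type*} [Fintype ι]

/-- The system of equations attached to a family of arcs from `s p` to `t p` with labels `a p`:
there are vectors `x p` starting with `ℓ p` in position `s p` and vectors `y p` ending with `ρ p`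
in position `t p`, such that the sum of the matrices `a p • x p ⊗ y p` vanishes strictly above the
diagonal of `K × K`. -/
def Solvable (K : Finset (Fin n)) (s t : ι → Fin n) (a ℓ ρ : ι → F) : Prop :=
  ∃ x y : ι → Fin n → F,
    (∀ p, x p (s p) = ℓ p ∧ ∀ j < s p, x p j = 0) ∧
    (∀ p, y p (t p) = ρ p ∧ ∀ k, t p < k → y p k = 0) ∧
    ∀ j ∈ K, ∀ k ∈ K, j < k → ∑ p, a p * x p j * y p k = 0

omit [Fintype ι] in
/-- Vectors with distinct leading positions have a dual basis supported on these positions. -/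
theorem exists_dual_of_leading {T : Type*} [LinearOrder T] [Fintype T] (I : Finset ι) {s : ι → T}
    (hs : Set.InjOn s I) {x : ι → T → F} (h1 : ∀ p ∈ I, x p (s p) ≠ 0)
    (h0 : ∀ p ∈ I, ∀ j < s p, x p j = 0) [DecidableEq ι] (β : ι) (hβ : β ∈ I) :
    ∃ r : T → F, (∀ j, r j ≠ 0 → j ≤ s β ∧ ∃ α ∈ I, s α = j) ∧
      ∀ α ∈ I, ∑ j, r j * x α j = if α = β then 1 else 0 := by
  induction h : s β using WellFoundedLT.induction generalizing β with
  | ind m ih =>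
  subst h
  choose! r hr1 hr2 using fun α (hα : α ∈ I ∧ s α < s β) => ih (s α) hα.2 α hα.1 rfl
  -- Back substitution: the coordinate at `s β` already kills the vectors that start later, and the
  -- functionals dual to the vectors that start earlier correct the rest.
  refine ⟨fun j => (x β (s β))⁻¹ * ((if j = s β then 1 else 0) -
    ∑ α ∈ I with s α < s β, x α (s β) * r α j), ?_, ?_⟩
  · intro j hj
    by_cases hjs : j = s β
    · exact ⟨hjs.le, β, hβ, hjs.symm⟩
    · have h2 := right_ne_zero_of_mul hj
      rw [if_neg hjs, zero_sub, neg_ne_zero] at h2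
      obtain ⟨α, hα, hne⟩ := Finset.exists_ne_zero_of_sum_ne_zero h2
      have hα' := Finset.mem_filter.mp hα
      obtain ⟨h3, h4⟩ := hr1 α hα' j (right_ne_zero_of_mul hne)
      exact ⟨h3.trans hα'.2.le, h4⟩
  · intro α hα
    have e : ∑ j, (x β (s β))⁻¹ * ((if j = s β then 1 else 0) -
        ∑ α ∈ I with s α < s β, x α (s β) * r α j) * x α j =
        (x β (s β))⁻¹ * (x α (s β) - ∑ α' ∈ I with s α' < s β,
          x α' (s β) * ∑ j, r α' j * x α j) := by
      simp_rw [mul_assoc, ← Finset.mul_sum, sub_mul, Finset.sum_sub_distrib, Finset.sum_mul,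
        Finset.mul_sum]
      rw [Finset.sum_comm]
      simp [mul_assoc]
    rw [e, Finset.sum_congr rfl fun α' hα' => by rw [hr2 α' (Finset.mem_filter.mp hα') α hα]]
    simp only [mul_ite, mul_one, mul_zero, Finset.sum_ite_eq, Finset.mem_filter, hα, true_and]
    by_cases hαβ : α = β
    · subst hαβ
      simp [h1 α hα]
    · rw [if_neg hαβ]
      rcases lt_or_gt_of_ne (fun h => hαβ (hs hα hβ h)) with h | h
      · simp [h]
      · simp [h.not_gt, h0 α hα _ h]

variable {K : Finset (Fin n)} {s t : ι → Fin n} {a ℓ ρ : ι → F}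

/-- Hall's condition holds for a solvable system. -/
theorem card_le_card_nested (hst : ∀ p, s p < t p) (ha : ∀ p, a p ≠ 0)
    (hℓK : ∀ p, ℓ p ≠ 0 → s p ∈ K) (hρK : ∀ p, ρ p ≠ 0 → t p ∈ K)
    (hℓ : Set.InjOn s {p | ℓ p ≠ 0}) (hρ : Set.InjOn t {p | ρ p ≠ 0})
    (hsol : Solvable K s t a ℓ ρ) (S N : Finset ι)
    (hS : ∀ β ∈ S, ℓ β ≠ 0 ∧ ρ β ≠ 0)
    (hN : ∀ γ, γ ∈ N ↔ (ℓ γ = 0 ∧ ρ γ = 0) ∧ ∃ β ∈ S, s γ < s β ∧ t β < t γ) :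
    S.card ≤ N.card := by
  classical
  obtain ⟨x, y, hx, hy, hxy⟩ := hsol
  choose! r hr1 hr2 using exists_dual_of_leading (Finset.univ.filter fun p => ℓ p ≠ 0) (s := s)
    (x := x) (by simpa using hℓ) (fun p hp => by rw [(hx p).1]; simpa using hp)
    (fun p _ => (hx p).2)
  -- Trailing positions are leading positions for the reversed order.
  choose! c hc1 hc2 using exists_dual_of_leading (T := (Fin n)ᵒᵈ)
    (Finset.univ.filter fun p => ρ p ≠ 0) (s := t)
    (x := y) (fun p hp q hq e => hρ (by simpa using hp) (by simpa using hq) e) (fun p hp => by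
      have := (hy p).1
      rw [this]; simpa using hp)
    (fun p _ => (hy p).2)
  simp only [Finset.mem_filter, Finset.mem_univ, true_and] at hr1 hr2 hc1 hc2
  let P : ι → ι → F := fun β p => ∑ j, r β j * x p j
  let Q : ι → ι → F := fun β p => ∑ k : Fin n, c β k * y p k
  have hP : ∀ β, ℓ β ≠ 0 → ∀ p, ℓ p = 0 → P β p ≠ 0 → s p < s β := by
    intro β hβ p hp hne
    obtain ⟨j, -, hj⟩ := Finset.exists_ne_zero_of_sum_ne_zero hne
    have h1 := (hr1 β hβ j (left_ne_zero_of_mul hj)).1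
    refine lt_of_lt_of_le (lt_of_not_ge fun h => right_ne_zero_of_mul hj ?_) h1
    rcases h.lt_or_eq with h | h
    · exact (hx p).2 j h
    · rw [h, (hx p).1, hp]
  have hQ : ∀ β, ρ β ≠ 0 → ∀ p, ρ p = 0 → Q β p ≠ 0 → t β < t p := by
    intro β hβ p hp hne
    obtain ⟨k, -, hk⟩ := Finset.exists_ne_zero_of_sum_ne_zero hne
    have h1 : t β ≤ k := (hc1 β hβ k (left_ne_zero_of_mul hk)).1
    refine lt_of_le_of_lt h1 (lt_of_not_ge fun h => right_ne_zero_of_mul hk ?_)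
    rcases h.lt_or_eq with h | h
    · exact (hy p).2 k h
    · rw [← h, (hy p).1, hp]
  -- The functional `r β` lives on positions of `K` up to `s β` and `c β'` on positions of `K` from
  -- `t β'` on. As `s β < t β ≤ t β'`, only entries strictly above the diagonal are involved.
  have hzero : ∀ β ∈ S, ∀ β' ∈ S, ¬ t β' < t β → ∑ p, a p * P β p * Q β' p = 0 := by
    intro β hβ β' hβ' hlt
    have e : ∑ p, a p * P β p * Q β' p =
        ∑ j, ∑ k : Fin n, r β j * c β' k * ∑ p, a p * x p j * y p k := by
      have : ∀ p, a p * P β p * Q β' p =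
          ∑ j, ∑ k : Fin n, r β j * c β' k * (a p * x p j * y p k) := fun p => by
        simp only [P, Q, mul_assoc, Finset.sum_mul, Finset.mul_sum]
        rw [Finset.sum_comm]
        exact Finset.sum_congr rfl fun j _ => Finset.sum_congr rfl fun k _ => by ring
      simp_rw [this, Finset.mul_sum]
      exact Finset.sum_comm.trans (Finset.sum_congr rfl fun j _ => Finset.sum_comm)
    rw [e]
    refine Finset.sum_eq_zero fun j _ => Finset.sum_eq_zero fun k _ => ?_
    by_contra hne
    have h1 := left_ne_zero_of_mul hne
    obtain ⟨h2, α, hα, rfl⟩ := hr1 β (hS β hβ).1 j (left_ne_zero_of_mul h1)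
    obtain ⟨h3, α', hα', rfl⟩ := hc1 β' (hS β' hβ').2 k (right_ne_zero_of_mul h1)
    refine right_ne_zero_of_mul hne (hxy _ (hℓK α hα) _ (hρK α' hα') ?_)
    by_contra h4
    have h3' : t β' ≤ t α' := h3
    exact hlt ((h3'.trans (not_lt.mp h4)).trans_lt (h2.trans_lt (hst β)))
  -- Outside `N`, duality removes every arc with a filled end except `β` itself when `β = β'`. A
  -- hollow arc with a nonzero term would strictly contain `β` and so lie in `N`.
  have hB : ∀ β ∈ S, ∀ β' ∈ S, ¬ t β' < t β →
      ∑ γ ∈ N, a γ * P β γ * Q β' γ = if β = β' then -a β else 0 := by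
    intro β hβ β' hβ' hlt
    have h1 := hzero β hβ β' hβ' hlt
    have h2 : ∀ p ∈ Finset.univ.filter (fun p => p ∉ N), a p * P β p * Q β' p =
        if p = β then (if β = β' then a β else 0) else 0 := by
      intro p hp
      have hpN := (Finset.mem_filter.mp hp).2
      by_cases hℓp : ℓ p = 0
      · have hpβ : p ≠ β := fun h => (hS β hβ).1 (h ▸ hℓp)
        rw [if_neg hpβ]
        by_cases hρp : ρ p = 0
        · by_contra hne
          have h3 := hP β (hS β hβ).1 p hℓp (right_ne_zero_of_mul (left_ne_zero_of_mul hne))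
          have h4 := hQ β' (hS β' hβ').2 p hρp (right_ne_zero_of_mul hne)
          refine hlt (h4.trans_le (not_lt.mp fun h5 => hpN ?_))
          exact (hN p).mpr ⟨⟨hℓp, hρp⟩, β, hβ, h3, h5⟩
        · have : Q β' p = 0 := (hc2 β' (hS β' hβ').2 p hρp).trans
            (if_neg fun h : p = β' => (hS β' hβ').1 (h ▸ hℓp))
          rw [this, mul_zero]
      · have h3 : P β p = if p = β then 1 else 0 := hr2 β (hS β hβ).1 p hℓp
        rw [h3]
        by_cases hpβ : p = β
        · subst hpβ
          have : Q β' p = if p = β' then 1 else 0 := hc2 β' (hS β' hβ').2 p (hS p hβ).2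
          rw [this]
          simp
        · simp [hpβ]
    rw [← Finset.sum_filter_add_sum_filter_not _ (fun p => p ∈ N), Finset.sum_congr rfl h2,
      Finset.sum_ite_eq', Finset.filter_mem_eq_inter, Finset.univ_inter, if_pos] at h1
    · rw [eq_neg_of_add_eq_zero_left h1]
      split_ifs <;> simp
    · refine Finset.mem_filter.mpr ⟨Finset.mem_univ _, fun h => ?_⟩
      exact (hS β hβ).1 ((hN β).mp h).1.1
  -- By `hB` the matrix `∑ γ ∈ N, a γ * P β γ * Q β' γ` is triangular for the order of right
  -- endpoints, with diagonal `-a β`. Hence its second factor `Φ` is injective.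
  let Φ : Matrix N S F := Matrix.of fun γ β => Q β γ
  have hinj : Function.Injective Φ.mulVecLin := by
    rw [injective_iff_map_eq_zero]
    intro v hv
    by_contra hne
    have hne' : (Finset.univ.filter fun β : S => v β ≠ 0).Nonempty := by
      obtain ⟨β, hβ⟩ := Function.ne_iff.mp hne
      exact ⟨β, by simpa using hβ⟩
    -- With `t β` minimal in the support of `v`, only the entries controlled by `hB` occur.
    obtain ⟨β, hβ, hmin⟩ := Finset.exists_min_image _ (fun β : S => t β) hne'
    have hβ0 : v β ≠ 0 := (Finset.mem_filter.mp hβ).2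
    have h1 : ∑ γ ∈ N.attach, a γ * P β γ * ∑ β' : S, Q β' γ * v β' = 0 :=
      Finset.sum_eq_zero fun γ _ => by
        have : ∑ β' : S, Q β' γ * v β' = 0 := congrFun hv γ
        rw [this, mul_zero]
    have h2 : ∑ γ ∈ N.attach, a γ * P β γ * ∑ β' : S, Q β' γ * v β' =
        ∑ β' : S, (∑ γ ∈ N, a γ * P β γ * Q β' γ) * v β' := by
      simp_rw [Finset.mul_sum, Finset.sum_mul]
      rw [Finset.sum_comm]
      refine Finset.sum_congr rfl fun β' _ => ?_
      rw [← Finset.sum_attach N]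
      exact Finset.sum_congr rfl fun γ _ => by ring
    rw [h2, Finset.sum_eq_single β] at h1
    · rw [hB β β.2 β β.2 (lt_irrefl _), if_pos rfl] at h1
      exact mul_ne_zero (neg_ne_zero.mpr (ha β)) hβ0 h1
    · intro β' _ hβ'
      by_cases hv' : v β' = 0
      · rw [hv', mul_zero]
      · rw [hB β β.2 β' β'.2 (hmin β' (by simpa using hv')).not_gt,
          if_neg fun h => hβ' (Subtype.ext h.symm), zero_mul]
    · simp
  have := LinearMap.finrank_le_finrank_of_injective hinj
  simpa using this

/-- If the filled left endpoints are distinct and the filled right endpoints are distinct, the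
system is solvable if and only if the filled arcs can be matched to hollow arcs around them. -/
theorem solvable_iff_exists_injective (hst : ∀ p, s p < t p) (ha : ∀ p, a p ≠ 0)
    (hℓK : ∀ p, ℓ p ≠ 0 → s p ∈ K) (hρK : ∀ p, ρ p ≠ 0 → t p ∈ K)
    (hℓ : Set.InjOn s {p | ℓ p ≠ 0}) (hρ : Set.InjOn t {p | ρ p ≠ 0}) :
    Solvable K s t a ℓ ρ ↔ ∃ f : {p // ℓ p ≠ 0 ∧ ρ p ≠ 0} → ι, Function.Injective f ∧
      ∀ p, (ℓ (f p) = 0 ∧ ρ (f p) = 0) ∧ s (f p) < s p ∧ t p < t (f p) := by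
  classical
  constructor
  · intro hsol
    let T : {p // ℓ p ≠ 0 ∧ ρ p ≠ 0} → Finset ι := fun β =>
      Finset.univ.filter fun γ => (ℓ γ = 0 ∧ ρ γ = 0) ∧ s γ < s β ∧ t β < t γ
    obtain ⟨f, hf, hfT⟩ := (Finset.all_card_le_biUnion_card_iff_exists_injective T).mp
      fun S => by
        rw [← Finset.card_map (Function.Embedding.subtype _)]
        refine card_le_card_nested hst ha hℓK hρK hℓ hρ hsol _ _ ?_ ?_
        · intro β hβ
          obtain ⟨β, -, rfl⟩ := Finset.mem_map.mp hβ
          exact β.2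
        · intro γ
          simp only [Finset.mem_biUnion, T, Finset.mem_filter, Finset.mem_univ, true_and,
            Finset.mem_map, Function.Embedding.subtype_apply]
          constructor
          · rintro ⟨β, hβ, h1, h2⟩
            exact ⟨h1, β, ⟨β, hβ, rfl⟩, h2⟩
          · rintro ⟨h1, -, ⟨β, hβ, rfl⟩, h2⟩
            exact ⟨β, hβ, h1, h2⟩
    exact ⟨f, hf, fun p => (Finset.mem_filter.mp (hfT p)).2⟩
  · rintro ⟨f, hf, h⟩
    -- A filled arc gets multiples of unit vectors at its ends, and the hollow arc matched to it
    -- gets the tensor cancelling this one; strict nesting makes the required end entries zero. In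
    -- all other arcs one factor is zero, so the whole tensor sum vanishes.
    let x : ι → Fin n → F := fun p j => if ℓ p ≠ 0 then (if j = s p then ℓ p else 0) else
      ∑ β, if f β = p then (if j = s β then 1 else 0) else 0
    let y : ι → Fin n → F := fun p k => if ρ p ≠ 0 then (if k = t p then ρ p else 0) else
      ∑ β, if f β = p then (if k = t β then -(a β * ℓ β * ρ β) / a p else 0) else 0
    refine ⟨x, y, fun p => ?_, fun p => ?_, fun j _ k _ _ => ?_⟩
    · by_cases hp : ℓ p = 0
      · have : ∀ j ≤ s p, x p j = 0 := fun j hj => by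
          simp only [x, hp, ne_eq, not_true_eq_false, if_false]
          refine Finset.sum_eq_zero fun β _ => ?_
          split_ifs with h1 h2
          · subst h1 h2
            exact absurd (h β).2.1 hj.not_gt
          · rfl
          · rfl
        exact ⟨by rw [this _ le_rfl, hp], fun j hj => this j hj.le⟩
      · exact ⟨by simp [x, hp], fun j hj => by simp [x, hp, hj.ne]⟩
    · by_cases hp : ρ p = 0
      · have : ∀ k, t p ≤ k → y p k = 0 := fun k hk => by
          simp only [y, hp, ne_eq, not_true_eq_false, if_false]
          refine Finset.sum_eq_zero fun β _ => ?_
          split_ifs with h1 h2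
          · subst h1 h2
            exact absurd (h β).2.2 hk.not_gt
          · rfl
          · rfl
        exact ⟨by rw [this _ le_rfl, hp], fun j hj => this j hj.le⟩
      · exact ⟨by simp [y, hp], fun j hj => by simp [y, hp, hj.ne']⟩
    · let w : ι → F := fun p => a p * ℓ p * ρ p * if j = s p ∧ k = t p then 1 else 0
      have hterm : ∀ p, a p * x p j * y p k = (if ℓ p ≠ 0 ∧ ρ p ≠ 0 then w p else 0) -
          ∑ β : {p // ℓ p ≠ 0 ∧ ρ p ≠ 0}, if f β = p then w β else 0 := by
        intro p
        by_cases hp : ∃ β, f β = p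
        · obtain ⟨β, rfl⟩ := hp
          have e : ∀ (v : {p // ℓ p ≠ 0 ∧ ρ p ≠ 0} → F),
              (∑ β', if f β' = f β then v β' else 0) = v β := fun v => by
            simp [hf.eq_iff]
          simp only [x, y, (h β).1.1, (h β).1.2, ne_eq, not_true_eq_false, if_false, and_self, e,
            w, ite_and]
          have := ha (f β)
          split_ifs <;> field_simp <;> ring
        · push Not at hp
          have e : ∀ (v : {p // ℓ p ≠ 0 ∧ ρ p ≠ 0} → F),
              (∑ β', if f β' = p then v β' else 0) = 0 := fun v => by
            simp [hp]
          simp only [x, y, e, w, ite_and]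
          split_ifs <;> simp_all
      simp_rw [hterm]
      rw [Finset.sum_sub_distrib, Finset.sum_comm]
      simp only [Finset.sum_ite_eq, Finset.mem_univ, if_true]
      rw [← Finset.sum_filter, Finset.sum_subtype (p := fun p => ℓ p ≠ 0 ∧ ρ p ≠ 0)
        (Finset.univ.filter fun p => ℓ p ≠ 0 ∧ ρ p ≠ 0) (by simp) w, sub_self]

end Systems
-- Moves between systems
section Operations

variable {n : ℕ} {F : Type*} [Field F] {ι : Type*} [Fintype ι]
variable {K : Finset (Fin n)} {s t : ι → Fin n} {a ℓ ρ : ι → F}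

/-- The leading entries of arcs starting outside of `K` and the trailing entries of arcs ending
outside of `K` do not matter. -/
theorem Solvable.congr_of_mem {ℓ' ρ' : ι → F} (hℓ : ∀ p, s p ∈ K → ℓ' p = ℓ p)
    (hρ : ∀ p, t p ∈ K → ρ' p = ρ p) (h : Solvable K s t a ℓ ρ) : Solvable K s t a ℓ' ρ' := by
  obtain ⟨x, y, hx, hy, hxy⟩ := h
  refine ⟨fun p j => if j = s p then ℓ' p else x p j, fun p k => if k = t p then ρ' p else y p k,
    fun p => ⟨if_pos rfl, fun j hj => by simp [hj.ne, (hx p).2 j hj]⟩,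
    fun p => ⟨if_pos rfl, fun k hk => by simp [hk.ne', (hy p).2 k hk]⟩,
    fun j hj k hk hjk => ?_⟩
  rw [← hxy j hj k hk hjk]
  refine Finset.sum_congr rfl fun p _ => ?_
  dsimp only
  congr 2
  · split_ifs with h
    · rw [hℓ p (h ▸ hj), h, (hx p).1]
    · rfl
  · split_ifs with h
    · rw [hρ p (h ▸ hk), h, (hy p).1]
    · rfl

variable [DecidableEq ι]

/-- Replacing `x p` by `x p + c • x p'` creates the term `c * a p` times `x p' ⊗ y p`, which is
absorbed by changing `y p'`. The inequalities between endpoints keep the supports admissible, and an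
end entry changes only where the endpoints coincide. -/
theorem Solvable.operation {p p' : ι} (hne : p ≠ p') (hs : s p ≤ s p') (ht : t p ≤ t p')
    (ha : a p' ≠ 0) (c : F) (h : Solvable K s t a ℓ ρ) :
    Solvable K s t a (Function.update ℓ p (ℓ p + if s p = s p' then c * ℓ p' else 0))
      (Function.update ρ p' (ρ p' - if t p = t p' then c * a p / a p' * ρ p else 0)) := by
  obtain ⟨x, y, hx, hy, hxy⟩ := h
  refine ⟨Function.update x p (x p + c • x p'),
    Function.update y p' (y p' - (c * a p / a p') • y p), fun q => ?_, fun q => ?_,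
    fun j hj k hk hjk => ?_⟩
  · by_cases hq : q = p
    · subst hq
      simp only [Function.update_self, Pi.add_apply, Pi.smul_apply, smul_eq_mul, (hx q).1]
      refine ⟨?_, fun j hj => by rw [(hx q).2 j hj, (hx p').2 j (hj.trans_le hs)]; simp⟩
      split_ifs with h
      · rw [h, (hx p').1]
      · rw [(hx p').2 _ (lt_of_le_of_ne hs h)]; simp
    · simpa only [Function.update_of_ne hq] using hx q
  · by_cases hq : q = p'
    · subst hq
      simp only [Function.update_self, Pi.sub_apply, Pi.smul_apply, smul_eq_mul, (hy q).1]
      refine ⟨?_, fun j hj => by rw [(hy q).2 j hj, (hy p).2 j (ht.trans_lt hj)]; simp⟩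
      split_ifs with h
      · rw [← h, (hy p).1]
      · rw [(hy p).2 _ (lt_of_le_of_ne ht h)]; simp
    · simpa only [Function.update_of_ne hq] using hy q
  · have hterm : ∀ q, a q * Function.update x p (x p + c • x p') q j *
        Function.update y p' (y p' - (c * a p / a p') • y p) q k =
        a q * x q j * y q k + (if q = p then c * a p * x p' j * y p k else 0) -
          if q = p' then c * a p * x p' j * y p k else 0 := by
      intro q
      by_cases h1 : q = p
      · subst h1
        simp [hne]
        ring
      · by_cases h2 : q = p'
        · subst h2
          simp [h1]
          field_simp
        · simp [h1, h2]
    simp_rw [hterm, Finset.sum_sub_distrib, Finset.sum_add_distrib]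
    simp [hxy j hj k hk hjk]

theorem solvable_operation_iff {p p' : ι} (hne : p ≠ p') (hs : s p ≤ s p') (ht : t p ≤ t p')
    (ha : a p' ≠ 0) (c : F) :
    Solvable K s t a ℓ ρ ↔
    Solvable K s t a (Function.update ℓ p (ℓ p + if s p = s p' then c * ℓ p' else 0))
      (Function.update ρ p' (ρ p' - if t p = t p' then c * a p / a p' * ρ p else 0)) := by
  refine ⟨Solvable.operation hne hs ht ha c, fun h => ?_⟩
  have h' := h.operation hne hs ht ha (-c)
  convert h' using 1
  · ext q
    by_cases hq : q = p
    · subst hq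
      simp only [Function.update_self, Function.update_of_ne hne.symm]
      split_ifs <;> ring
    · simp [hq]
  · ext q
    by_cases hq : q = p'
    · subst hq
      simp only [Function.update_self, Function.update_of_ne hne]
      split_ifs <;> ring
    · simp [hq]

/-- Two filled parallel arcs whose labels sum to zero become one arc with a hollow left end and one
with a hollow right end; otherwise they become a filled and a hollow arc. -/
theorem exists_solvable_iff_of_parallel {p q : ι} (hne : p ≠ q) (hs : s p = s q) (ht : t p = t q)
    (hap : a p ≠ 0) (haq : a q ≠ 0) (hℓp : ℓ p = 1) (hℓq : ℓ q = 1) (hρp : ρ p = 1)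
    (hρq : ρ q = 1) : ∃ ℓ' ρ' : ι → F, (Solvable K s t a ℓ ρ ↔ Solvable K s t a ℓ' ρ') ∧
      (∀ r, r ≠ p → r ≠ q → ℓ' r = ℓ r ∧ ρ' r = ρ r) ∧
      (ℓ' p ≠ 0 ↔ a p + a q = 0) ∧ (ℓ' q ≠ 0 ↔ a p + a q ≠ 0) ∧ ρ' p = 0 ∧ ρ' q ≠ 0 := by
  by_cases h0 : a p + a q = 0
  -- Subtracting `x p` from `x q` makes the left end of `q` hollow and turns `ρ p` into `1 + a q / a
  -- p = 0`, so one move clears both ends.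
  · refine ⟨_, _, solvable_operation_iff hne.symm hs.ge ht.ge hap (-1), fun r h1 h2 => ?_, ?_⟩
    · simp [h1, h2]
    · have : a q = -a p := by linear_combination h0
      simp [hne, hne.symm, hs, ht, hℓp, hℓq, hρp, hρq, this, hap]
  · have hw : 1 + a p / a q ≠ 0 := by
      intro h
      field_simp at h
      exact h0 (by linear_combination h)
    -- The first move gives `ℓ p = 0` and `ρ q = 1 + a p / a q ≠ 0`. The constant of the second is
    -- chosen so that `ρ p` becomes zero; it leaves `ℓ q` alone because `ℓ p` is already zero.
    refine ⟨_, _, (solvable_operation_iff hne hs.le ht.le haq (-1)).trans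
      (solvable_operation_iff hne.symm hs.ge ht.ge hap (a p / (a q * (1 + a p / a q)))),
      fun r h1 h2 => ?_, ?_⟩
    · simp [h1, h2]
    · have e : 1 - a p / (a q * (1 + a p / a q)) * a q / a p * (1 + a p / a q) = 0 := by
        have h0' : a q + a p ≠ 0 := by rwa [add_comm]
        field_simp
        ring
      simp [hne, hne.symm, hs, ht, h0, hℓp, hℓq, hρp, hρq, neg_div, hw, e]

end Operations

/-! ### Hollowing the lower ends -/

section Stacking

variable {n : ℕ} {F : Type*} [Field F] {ι : Type*} [Fintype ι] [LinearOrder ι]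

/-- `p` starts below `q`, for families of arcs in which at most two arcs are parallel. -/
def StartsUnder (s t : ι → Fin n) (a : ι → F) (p q : ι) : Prop :=
  s p = s q ∧ (t p < t q ∨ t p = t q ∧ (p < q ∧ a p + a q ≠ 0 ∨ q < p ∧ a p + a q = 0))

/-- `p` ends below `q`, for families of arcs in which at most two arcs are parallel. -/
def EndsUnder (s t : ι → Fin n) (p q : ι) : Prop :=
  t p = t q ∧ (s q < s p ∨ s p = s q ∧ p < q)

variable {K : Finset (Fin n)} {s t : ι → Fin n} {a : ι → F}

omit [Fintype ι] in
theorem StartsUnder.asymm {p q : ι} (h : StartsUnder s t a p q) : ¬ StartsUnder s t a q p := by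
  rintro ⟨-, h'⟩
  obtain ⟨-, h⟩ := h
  rw [add_comm (a q)] at h'
  rcases h with h | ⟨h1, ⟨h2, h3⟩ | ⟨h2, h3⟩⟩ <;>
  rcases h' with h' | ⟨h1', ⟨h2', h3'⟩ | ⟨h2', h3'⟩⟩
  · exact h.asymm h'
  · exact h.ne' h1'
  · exact h.ne' h1'
  · exact h'.ne' h1
  · exact h2.asymm h2'
  · exact h3 h3'
  · exact h'.ne' h1
  · exact h3' h3
  · exact h2.asymm h2'

omit [Fintype ι] in
theorem StartsUnder.ne {p q : ι} (h : StartsUnder s t a p q) : p ≠ q := by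
  rintro rfl
  exact h.asymm h

omit [Fintype ι] in
theorem EndsUnder.asymm {p q : ι} (h : EndsUnder s t p q) : ¬ EndsUnder s t q p := by
  rintro ⟨-, h'⟩
  obtain ⟨-, h⟩ := h
  rcases h with h | ⟨h1, h2⟩ <;> rcases h' with h' | ⟨h1', h2'⟩
  · exact h.asymm h'
  · exact h.ne h1'
  · exact h'.ne h1
  · exact h2.asymm h2'

omit [Fintype ι] in
theorem EndsUnder.ne {p q : ι} (h : EndsUnder s t p q) : p ≠ q := by
  rintro rfl
  exact h.asymm h

/-- The left ends of the arcs `p ∈ S` can be made hollow, where `p` starts below an arc. -/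
theorem solvable_iff_hollow_left (ha : ∀ p, a p ≠ 0)
    (hs2 : ∀ p q r, s p = s q → s p = s r → p = q ∨ p = r ∨ q = r) (S : Finset ι)
    (hS : ∀ p ∈ S, s p ∈ K ∧ ∃ q, StartsUnder s t a p q ∧ (t p < t q ∨ t p ∉ K)) :
    Solvable K s t a (fun p => if s p ∈ K then 1 else 0) (fun p => if t p ∈ K then 1 else 0) ↔
      Solvable K s t a (fun p => if p ∉ S ∧ s p ∈ K then 1 else 0)
        (fun p => if t p ∈ K then 1 else 0) := by
  induction S using Finset.induction_on with
  | empty => simp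
  | insert p S hp ih =>
    obtain ⟨hpK, q, hq, hqt⟩ := hS p (Finset.mem_insert_self p S)
    -- Only two arcs start at this node, so the upper arc `q` still has a filled left end and can be
    -- used to clear `p`.
    have hqS : q ∉ S := fun hqS => by
      obtain ⟨-, r, hr, -⟩ := hS q (Finset.mem_insert_of_mem hqS)
      rcases hs2 p q r hq.1 (hq.1.trans hr.1) with rfl | rfl | rfl
      · exact hq.ne rfl
      · exact hq.asymm hr
      · exact hr.ne rfl
    have htpq : t p ≤ t q := hq.2.elim le_of_lt fun h => h.1.le
    rw [ih fun r hr => hS r (Finset.mem_insert_of_mem hr),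
      solvable_operation_iff hq.ne hq.1.le htpq (ha q) (-1)]
    refine iff_of_eq ?_
    congr 1
    · ext r
      by_cases hr : r = p
      · subst hr
        simp [hp, hq.1, hqS, hq.1 ▸ hpK]
      · simp [hr]
    · ext r
      by_cases hr : r = q
      · subst hr
        -- The side effect on `ρ q` is absent: either the right endpoints differ or `ρ p = 0`.
        rcases hqt with h | h
        · simp [h.ne]
        · simp [h]
      · simp [hr]

/-- The right ends of the arcs `p ∈ S` can be made hollow, where `p` ends below an arc. -/
theorem solvable_iff_hollow_right (ha : ∀ p, a p ≠ 0)
    (ht2 : ∀ p q r, t p = t q → t p = t r → p = q ∨ p = r ∨ q = r) (ℓ : ι → F)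
    (hℓ : ∀ p, s p ∉ K → ℓ p = 0) (S : Finset ι)
    (hS : ∀ p ∈ S, t p ∈ K ∧ ∃ q, EndsUnder s t p q ∧ (s q < s p ∨ s p ∉ K)) :
    Solvable K s t a ℓ (fun p => if t p ∈ K then 1 else 0) ↔
      Solvable K s t a ℓ (fun p => if p ∉ S ∧ t p ∈ K then 1 else 0) := by
  induction S using Finset.induction_on with
  | empty => simp
  | insert p S hp ih =>
    obtain ⟨hpK, q, hq, hqs⟩ := hS p (Finset.mem_insert_self p S)
    have hqS : q ∉ S := fun hqS => by
      obtain ⟨-, r, hr, -⟩ := hS q (Finset.mem_insert_of_mem hqS)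
      rcases ht2 p q r hq.1 (hq.1.trans hr.1) with rfl | rfl | rfl
      · exact hq.ne rfl
      · exact hq.asymm hr
      · exact hr.ne rfl
    have hspq : s q ≤ s p := hq.2.elim le_of_lt fun h => h.1.ge
    rw [ih fun r hr => hS r (Finset.mem_insert_of_mem hr),
      -- The constant makes the correction of `ρ p` equal to `ρ q = 1`; the left entry of `q` is
      -- unaffected since `s q < s p` or `ℓ p = 0`.
      solvable_operation_iff hq.ne.symm hspq hq.1.ge (ha p) (a p / a q)]
    refine iff_of_eq ?_
    congr 1
    · ext r
      by_cases hr : r = q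
      · subst hr
        rcases hqs with h | h
        · simp [h.ne]
        · simp [hℓ p h]
      · simp [hr]
    · ext r
      by_cases hr : r = p
      · subst hr
        have := ha r
        have := ha q
        simp [hp, hpK, ← hq.1, hqS]
        field_simp
        simp
      · simp [hr]

/-- The pairs of parallel arcs whose upper members lie in `S` can be replaced by arcs whose ends
are hollow if they lie below another arc. -/
theorem exists_solvable_iff_of_parallel_pairs (ha : ∀ p, a p ≠ 0)
    (hs2 : ∀ p q r, s p = s q → s p = s r → p = q ∨ p = r ∨ q = r)
    (ht2 : ∀ p q r, t p = t q → t p = t r → p = q ∨ p = r ∨ q = r) (ℓ ρ : ι → F) (S : Finset ι)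
    (hS : ∀ q ∈ S, (s q ∈ K ∧ t q ∈ K) ∧ ∃ p < q, s p = s q ∧ t p = t q)
    (hℓ : ∀ p q, p ≠ q → s p = s q → t p = t q → s p ∈ K → t p ∈ K → ℓ p = 1 ∧ ρ p = 1) :
    ∃ ℓ' ρ' : ι → F, (Solvable K s t a ℓ ρ ↔ Solvable K s t a ℓ' ρ') ∧
      ∀ r, if r ∈ S ∨ ∃ q ∈ S, r < q ∧ s r = s q ∧ t r = t q then
        (ℓ' r ≠ 0 ↔ s r ∈ K ∧ ¬ ∃ q, StartsUnder s t a r q) ∧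
        (ρ' r ≠ 0 ↔ t r ∈ K ∧ ¬ ∃ q, EndsUnder s t r q)
      else ℓ' r = ℓ r ∧ ρ' r = ρ r := by
  classical
  induction S using Finset.induction_on with
  | empty => exact ⟨ℓ, ρ, Iff.rfl, by simp⟩
  | insert q S hqS ih =>
    obtain ⟨ℓ', ρ', hsol, h⟩ := ih fun r hr => hS r (Finset.mem_insert_of_mem hr)
    obtain ⟨⟨hsK, htK⟩, p, hpq, hs, ht⟩ := hS q (Finset.mem_insert_self q S)
    have hthird : ∀ r, s r = s q → r = p ∨ r = q := fun r hr => by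
      rcases hs2 q p r hs.symm hr.symm with rfl | rfl | rfl
      · exact absurd hpq (lt_irrefl _)
      · exact Or.inr rfl
      · exact Or.inl rfl
    have hthird' : ∀ r, t r = t q → r = p ∨ r = q := fun r hr => by
      rcases ht2 q p r ht.symm hr.symm with rfl | rfl | rfl
      · exact absurd hpq (lt_irrefl _)
      · exact Or.inr rfl
      · exact Or.inl rfl
    -- Parallel pairs are disjoint, so the pairs already treated have not changed the entries of `p`
    -- and `q`.
    have hpS : p ∉ S := fun hp => by
      obtain ⟨-, r, hr, hsr, -⟩ := hS p (Finset.mem_insert_of_mem hp)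
      rcases hthird r (hsr.trans hs) with rfl | rfl
      · exact lt_irrefl _ hr
      · exact hr.asymm hpq
    have hp := h p
    rw [if_neg] at hp
    swap
    · rintro (h1 | ⟨q', h1, h2, h3, h4⟩)
      · exact hpS h1
      · rcases hthird q' (h3.symm.trans hs) with rfl | rfl
        · exact lt_irrefl _ h2
        · exact hqS h1
    have hq := h q
    rw [if_neg] at hq
    swap
    · rintro (h1 | ⟨q', h1, h2, h3, h4⟩)
      · exact hqS h1
      · rcases hthird q' h3.symm with rfl | rfl
        · exact h2.asymm hpq
        · exact lt_irrefl _ h2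
    have h1p := hℓ p q hpq.ne hs ht (hs ▸ hsK) (ht ▸ htK)
    have h1q := hℓ q p hpq.ne' hs.symm ht.symm hsK htK
    obtain ⟨ℓ'', ρ'', hsol', hoff, h1, h2, h3, h4⟩ := exists_solvable_iff_of_parallel (K := K)
      hpq.ne hs ht (ha p) (ha q) (hp.1.trans h1p.1) (hq.1.trans h1q.1) (hp.2.trans h1p.2)
      (hq.2.trans h1q.2)
    refine ⟨ℓ'', ρ'', hsol.trans hsol', fun r => ?_⟩
    by_cases hrp : r = p
    · subst hrp
      rw [if_pos (Or.inr ⟨q, Finset.mem_insert_self _ _, hpq, hs, ht⟩), h1]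
      refine ⟨⟨fun h0 => ⟨hs ▸ hsK, ?_⟩, fun h0 => ?_⟩, fun h0 => absurd h3 h0, fun h0 => ?_⟩
      · rintro ⟨r', hr'⟩
        rcases hthird r' (hr'.1.symm.trans hs) with rfl | rfl
        · exact hr'.ne rfl
        · rcases hr'.2 with h5 | ⟨-, ⟨-, h5⟩ | ⟨h5, -⟩⟩
          · exact h5.ne ht
          · exact h5 h0
          · exact h5.asymm hpq
      · by_contra h5
        exact h0.2 ⟨q, hs, Or.inr ⟨ht, Or.inl ⟨hpq, h5⟩⟩⟩
      · exact absurd ⟨q, ht, Or.inr ⟨hs, hpq⟩⟩ h0.2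
    by_cases hrq : r = q
    · subst hrq
      rw [if_pos (Or.inl (Finset.mem_insert_self _ _)), h2]
      refine ⟨⟨fun h0 => ⟨hsK, ?_⟩, fun h0 h5 => ?_⟩, fun _ => ⟨htK, ?_⟩, fun _ => h4⟩
      · rintro ⟨r', hr'⟩
        rcases hthird r' hr'.1.symm with rfl | rfl
        · rcases hr'.2 with h5 | ⟨-, ⟨h5, -⟩ | ⟨-, h5⟩⟩
          · exact h5.ne ht.symm
          · exact h5.asymm hpq
          · exact h0 ((add_comm _ _).trans h5)
        · exact hr'.ne rfl
      · exact h0.2 ⟨p, hs.symm, Or.inr ⟨ht.symm, Or.inr ⟨hpq, (add_comm _ _).trans h5⟩⟩⟩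
      · rintro ⟨r', hr'⟩
        rcases hthird' r' hr'.1.symm with rfl | rfl
        · rcases hr'.2 with h5 | ⟨-, h5⟩
          · exact h5.ne hs
          · exact h5.asymm hpq
        · exact hr'.ne rfl
    have hiff : (r ∈ insert q S ∨ ∃ q' ∈ insert q S, r < q' ∧ s r = s q' ∧ t r = t q') ↔
        (r ∈ S ∨ ∃ q' ∈ S, r < q' ∧ s r = s q' ∧ t r = t q') := by
      rw [Finset.mem_insert, or_iff_right hrq]
      refine or_congr Iff.rfl ⟨?_, fun ⟨q', h5, h6⟩ => ⟨q', Finset.mem_insert_of_mem h5, h6⟩⟩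
      rintro ⟨q', h5, h6, h7, h8⟩
      rcases Finset.mem_insert.mp h5 with rfl | h5
      · exact absurd (hthird r h7) (not_or.mpr ⟨hrp, hrq⟩)
      · exact ⟨q', h5, h6, h7, h8⟩
    simp only [hiff]
    rw [(hoff r hrp hrq).1, (hoff r hrp hrq).2]
    exact h r

/-- A system in which at most two arcs start at a node and at most two arcs end at a node is
equivalent to one in which the ends of arcs below others are hollow. -/
theorem exists_solvable_iff_stacked (ha : ∀ p, a p ≠ 0)
    (hs2 : ∀ p q r, s p = s q → s p = s r → p = q ∨ p = r ∨ q = r)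
    (ht2 : ∀ p q r, t p = t q → t p = t r → p = q ∨ p = r ∨ q = r) :
    ∃ ℓ ρ : ι → F, (Solvable K s t a (fun _ => 1) (fun _ => 1) ↔ Solvable K s t a ℓ ρ) ∧
      (∀ r, ℓ r ≠ 0 ↔ s r ∈ K ∧ ¬ ∃ q, StartsUnder s t a r q) ∧
      ∀ r, ρ r ≠ 0 ↔ t r ∈ K ∧ ¬ ∃ q, EndsUnder s t r q := by
  classical
  -- `SL` and `SR` collect the ends that can be cleared without affecting the opposite side. What
  -- remains, in `SP`, are the upper members of parallel pairs with both ends in `K`.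
  set SL : Finset ι := Finset.univ.filter fun p =>
    s p ∈ K ∧ ∃ q, StartsUnder s t a p q ∧ (t p < t q ∨ t p ∉ K) with hSL
  set SR : Finset ι := Finset.univ.filter fun p =>
    t p ∈ K ∧ ∃ q, EndsUnder s t p q ∧ (s q < s p ∨ s p ∉ K) with hSR
  set SP : Finset ι := Finset.univ.filter fun q =>
    (s q ∈ K ∧ t q ∈ K) ∧ ∃ p < q, s p = s q ∧ t p = t q with hSP
  have h0 : Solvable K s t a (fun _ => 1) (fun _ => 1) ↔
      Solvable K s t a (fun p => if s p ∈ K then 1 else 0) (fun p => if t p ∈ K then 1 else 0) :=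
    ⟨Solvable.congr_of_mem (fun p hp => if_pos hp) fun p hp => if_pos hp,
      Solvable.congr_of_mem (fun p hp => (if_pos hp).symm) fun p hp => (if_pos hp).symm⟩
  have h1 := solvable_iff_hollow_left (K := K) (t := t) ha hs2 SL (by simp [hSL])
  have h2 := solvable_iff_hollow_right (K := K) (s := s) ha ht2 (fun p => if p ∉ SL ∧ s p ∈ K then 1 else 0)
    (fun p hp => by simp [hp]) SR (by simp [hSR])
  obtain ⟨ℓ, ρ, h3, h4⟩ := exists_solvable_iff_of_parallel_pairs (K := K) ha hs2 ht2
    (fun p => if p ∉ SL ∧ s p ∈ K then 1 else 0) (fun p => if p ∉ SR ∧ t p ∈ K then 1 else 0) SP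
    (by simp [hSP]) fun p q hne hs ht hsK htK => by
      -- Such a pair uses up both places at its two endpoints, so the left and right clearing did
      -- not touch it.
      have hL : p ∉ SL := fun h => by
        obtain ⟨-, r, hr, h⟩ := (Finset.mem_filter.mp h).2
        replace h := h.resolve_right (not_not.mpr htK)
        rcases hs2 p q r hs hr.1 with rfl | rfl | rfl
        · exact hne rfl
        · exact hr.ne rfl
        · exact h.ne ht
      have hR : p ∉ SR := fun h => by
        obtain ⟨-, r, hr, h⟩ := (Finset.mem_filter.mp h).2
        replace h := h.resolve_right (not_not.mpr hsK)
        rcases ht2 p q r ht hr.1 with rfl | rfl | rfl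
        · exact hne rfl
        · exact hr.ne rfl
        · exact h.ne hs.symm
      simp [hL, hR, hsK, htK]
  refine ⟨ℓ, ρ, h0.trans (h1.trans (h2.trans h3)), fun r => ?_, fun r => ?_⟩
  · have h5 := h4 r
    by_cases h6 : r ∈ SP ∨ ∃ q ∈ SP, r < q ∧ s r = s q ∧ t r = t q
    · rw [if_pos h6] at h5
      exact h5.1
    · rw [if_neg h6] at h5
      rw [h5.1]
      simp only [ne_eq, ite_eq_right_iff, one_ne_zero, imp_false, not_not]
      refine ⟨fun ⟨h7, h8⟩ => ⟨h8, ?_⟩, fun ⟨h7, h8⟩ => ⟨fun h9 => ?_, h7⟩⟩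
      · rintro ⟨q, hq⟩
        have h9 : ¬ (t r < t q ∨ t r ∉ K) := fun h =>
          h7 (Finset.mem_filter.mpr ⟨Finset.mem_univ _, h8, q, hq, h⟩)
        push Not at h9
        have ht : t r = t q := (hq.2.resolve_left h9.1.not_gt).1
        rcases lt_or_gt_of_ne hq.ne with h | h
        · exact h6 (Or.inr ⟨q, Finset.mem_filter.mpr ⟨Finset.mem_univ _,
            ⟨hq.1 ▸ h8, ht ▸ h9.2⟩, r, h, hq.1, ht⟩, h, hq.1, ht⟩)
        · exact h6 (Or.inl (Finset.mem_filter.mpr ⟨Finset.mem_univ _,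
            ⟨h8, h9.2⟩, q, h, hq.1.symm, ht.symm⟩))
      · obtain ⟨-, q, hq, -⟩ := (Finset.mem_filter.mp h9).2
        exact h8 ⟨q, hq⟩
  · have h5 := h4 r
    by_cases h6 : r ∈ SP ∨ ∃ q ∈ SP, r < q ∧ s r = s q ∧ t r = t q
    · rw [if_pos h6] at h5
      exact h5.2
    · rw [if_neg h6] at h5
      rw [h5.2]
      simp only [ne_eq, ite_eq_right_iff, one_ne_zero, imp_false, not_not]
      refine ⟨fun ⟨h7, h8⟩ => ⟨h8, ?_⟩, fun ⟨h7, h8⟩ => ⟨fun h9 => ?_, h7⟩⟩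
      · rintro ⟨q, hq⟩
        have h9 : ¬ (s q < s r ∨ s r ∉ K) := fun h =>
          h7 (Finset.mem_filter.mpr ⟨Finset.mem_univ _, h8, q, hq, h⟩)
        push Not at h9
        have hs : s r = s q := (hq.2.resolve_left h9.1.not_gt).1
        rcases lt_or_gt_of_ne hq.ne with h | h
        · exact h6 (Or.inr ⟨q, Finset.mem_filter.mpr ⟨Finset.mem_univ _,
            ⟨hs ▸ h9.2, hq.1 ▸ h8⟩, r, h, hs, hq.1⟩, h, hs, hq.1⟩)
        · exact h6 (Or.inl (Finset.mem_filter.mpr ⟨Finset.mem_univ _,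
            ⟨h9.2, h8⟩, q, h, hs.symm, hq.1.symm⟩))
      · obtain ⟨-, q, hq, -⟩ := (Finset.mem_filter.mp h9).2
        exact h8 ⟨q, hq⟩

end Stacking
-- Enumerated arcs, heights and matchings
section ListArcs

variable {n : ℕ} {F : Type*} [Field F]

/-- Each of `lam` and `mu` contributes at most one arc with a given endpoint. This bound by two
underlies the whole stacking analysis. -/
theorem eq_of_three_get {A : List (Arc n F)} {lam mu : Multiset (Arc n F)}
    (hA : (A : Multiset (Arc n F)) = lam + bar mu) (f : Arc n F → Fin n)
    (hf : ∀ α, f α.bar = f α) (hlam : (lam.map f).Nodup) (hmu : (mu.map f).Nodup)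
    (p q r : Fin A.length) (hpq : f (A.get p) = f (A.get q)) (hpr : f (A.get p) = f (A.get r)) :
    p = q ∨ p = r ∨ q = r := by
  classical
  by_contra! hne
  have hval : (Finset.univ : Finset (Fin A.length)).val.map A.get = A := by
    rw [Fin.univ_val_map, List.ofFn_get]
  have h1 : (Finset.univ.filter fun x => f (A.get p) = f (A.get x)).card =
      (lam.map f).count (f (A.get p)) + (mu.map f).count (f (A.get p)) := by
    have h2 : (mu.map f) = (bar mu).map f := by
      rw [bar, Multiset.map_map]
      exact Multiset.map_congr rfl fun α _ => (hf α).symm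
    rw [h2, ← Multiset.count_add, ← Multiset.map_add, ← hA, ← hval, Multiset.map_map,
      Multiset.count_map]
    rfl
  have h3 : 2 < (Finset.univ.filter fun x => f (A.get p) = f (A.get x)).card :=
    Finset.two_lt_card.mpr ⟨p, by simp, q, by simpa using hpq, r, by simpa using hpr, hne⟩
  have h4 := Multiset.nodup_iff_count_le_one.mp hlam (f (A.get p))
  have h5 := Multiset.nodup_iff_count_le_one.mp hmu (f (A.get p))
  omega

theorem parallel_coe (A : List (Arc n F)) (j k : Fin n) :
    parallel (A : Multiset (Arc n F)) j k =
      (Finset.univ.filter fun p => (A.get p).left = j ∧ (A.get p).right = k).val.map A.get := by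
  have hval : (Finset.univ : Finset (Fin A.length)).val.map A.get = A := by
    rw [Fin.univ_val_map, List.ofFn_get]
  conv_lhs => rw [parallel, ← hval, Multiset.filter_map]
  rfl

variable {A : List (Arc n F)}
  (hs2 : ∀ p q r : Fin A.length, (A.get p).left = (A.get q).left →
    (A.get p).left = (A.get r).left → p = q ∨ p = r ∨ q = r)

include hs2

theorem filter_parallel {p q : Fin A.length} (hne : p ≠ q)
    (hs : (A.get p).left = (A.get q).left) (ht : (A.get p).right = (A.get q).right) :
    (Finset.univ.filter fun x => (A.get x).left = (A.get p).left ∧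
      (A.get x).right = (A.get p).right) = {p, q} := by
  ext x
  simp only [Finset.mem_filter, Finset.mem_univ, true_and, Finset.mem_insert,
    Finset.mem_singleton]
  constructor
  · rintro ⟨h, -⟩
    rcases hs2 p q x hs h.symm with h | h | h
    · exact absurd h hne
    · exact Or.inl h.symm
    · exact Or.inr h.symm
  · rintro (rfl | rfl)
    · exact ⟨rfl, rfl⟩
    · exact ⟨hs.symm, ht.symm⟩

theorem mult_of_parallel {p q : Fin A.length} (hne : p ≠ q)
    (hs : (A.get p).left = (A.get q).left) (ht : (A.get p).right = (A.get q).right) :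
    mult (A : Multiset (Arc n F)) (A.get p).left (A.get p).right = 2 := by
  rw [mult, parallel_coe, filter_parallel hs2 hne hs ht, Multiset.card_map, Finset.card_val,
    Finset.card_pair hne]

theorem wt_of_parallel {p q : Fin A.length} (hne : p ≠ q)
    (hs : (A.get p).left = (A.get q).left) (ht : (A.get p).right = (A.get q).right) :
    wt (A : Multiset (Arc n F)) (A.get p).left (A.get p).right =
      (A.get p).label + (A.get q).label := by
  rw [wt, parallel_coe, filter_parallel hs2 hne hs ht, Multiset.map_map]
  exact Finset.sum_pair (f := fun x => (A.get x).label) hne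

theorem pos_of_parallel {p q : Fin A.length} (hpq : p < q)
    (hs : (A.get p).left = (A.get q).left) (ht : (A.get p).right = (A.get q).right) :
    pos A p = 0 ∧ pos A q = 1 := by
  have e1 := filter_parallel hs2 hpq.ne hs ht
  have e2 := filter_parallel hs2 hpq.ne' hs.symm ht.symm
  constructor
  · rw [pos, Finset.card_eq_zero, Finset.filter_and, e1]
    ext x
    simp only [Finset.mem_inter, Finset.mem_filter, Finset.mem_univ, true_and, Finset.mem_insert,
      Finset.mem_singleton, Finset.notMem_empty, iff_false]
    rintro ⟨h, rfl | rfl⟩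
    · exact lt_irrefl _ h
    · exact h.asymm hpq
  · rw [pos, Finset.card_eq_one]
    refine ⟨p, ?_⟩
    rw [Finset.filter_and, e2]
    ext x
    simp only [Finset.mem_inter, Finset.mem_filter, Finset.mem_univ, true_and, Finset.mem_insert,
      Finset.mem_singleton]
    constructor
    · rintro ⟨h, rfl | rfl⟩
      · exact absurd h (lt_irrefl _)
      · rfl
    · rintro rfl
      exact ⟨hpq, Or.inr rfl⟩

/-- There are `m = 2` parallel arcs, so the exchange of heights `m - 2` and `m - 1` is that of `0`
and `1`. -/
theorem leftHeight_of_parallel [DecidableEq F] {p q : Fin A.length} (hpq : p < q)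
    (hs : (A.get p).left = (A.get q).left) (ht : (A.get p).right = (A.get q).right) :
    (leftHeight A p = if (A.get p).label + (A.get q).label = 0 then 1 else 0) ∧
      leftHeight A q = if (A.get p).label + (A.get q).label = 0 then 0 else 1 := by
  obtain ⟨h1, h2⟩ := pos_of_parallel hs2 hpq hs ht
  constructor
  · rw [leftHeight, wt_of_parallel hs2 hpq.ne hs ht, mult_of_parallel hs2 hpq.ne hs ht, h1]
    simp
  · rw [leftHeight, wt_of_parallel hs2 hpq.ne' hs.symm ht.symm,
      mult_of_parallel hs2 hpq.ne' hs.symm ht.symm, h2, add_comm (A.get q).label]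
    simp

theorem startsBelow_iff [DecidableEq F] (p q : Fin A.length) : StartsBelow A p q ↔
    StartsUnder (fun x => (A.get x).left) (fun x => (A.get x).right) (fun x => (A.get x).label)
      p q := by
  refine and_congr_right fun hs => or_congr Iff.rfl (and_congr_right fun ht => ?_)
  rcases lt_trichotomy p q with h | rfl | h
  · obtain ⟨h1, h2⟩ := leftHeight_of_parallel hs2 h hs ht
    rw [h1, h2]
    split_ifs with h0 <;> simpa [h, h.not_gt] using h0
  · simp
  · obtain ⟨h1, h2⟩ := leftHeight_of_parallel hs2 h hs.symm ht.symm
    rw [h1, h2, add_comm (A.get q).label]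
    split_ifs with h0 <;> simpa [h, h.not_gt] using h0

theorem endsBelow_iff (p q : Fin A.length) : EndsBelow A p q ↔
    EndsUnder (fun x => (A.get x).left) (fun x => (A.get x).right) p q := by
  refine and_congr_right fun ht => or_congr Iff.rfl (and_congr_right fun hs => ?_)
  rw [rightHeight, rightHeight]
  rcases lt_trichotomy p q with h | rfl | h
  · obtain ⟨h1, h2⟩ := pos_of_parallel hs2 h hs ht
    simp [h1, h2, h]
  · simp
  · obtain ⟨h1, h2⟩ := pos_of_parallel hs2 h hs.symm ht.symm
    simp [h1, h2, h.not_gt]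

omit hs2

/-- Uniqueness of partners makes the partner map injective. Conversely the graph of an injection is
a matching, as no vertex is both filled and hollow. -/
theorem hasCompleteMatching_iff_exists_injective [DecidableEq F] (K : Finset (Fin n))
    (A : List (Arc n F)) : HasCompleteMatching K A ↔
      ∃ f : VFilled K A → Fin A.length, Function.Injective f ∧
        ∀ p, f p ∈ VHollow K A ∧ Nested A (f p) p := by
  have hdisj : ∀ p, p ∈ VFilled K A → p ∉ VHollow K A := by
    intro p (h : (_, _) = (_, _)) (h' : (_, _) = (_, _))
    rw [h] at h'
    simp at h'
  constructor
  · rintro ⟨M, hM, hV⟩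
    choose f hf using fun p : VFilled K A => (hM (hV p.2)).exists
    refine ⟨f, fun p q hpq => ?_, fun p => ?_⟩
    · have h1 := (hf p).symm
      have h2 := (hf q).symm
      rw [hpq] at h1
      exact Subtype.ext ((hM h1.fst_mem).unique h1 h2)
    · rcases M.adj_sub (hf p) with h | h
      · exact absurd h.1 (hdisj _ p.2)
      · exact ⟨h.1, h.2.2⟩
  · rintro ⟨f, hf, h⟩
    refine ⟨{
      verts := VFilled K A ∪ Set.range f
      Adj := fun x y => (∃ p, x = f p ∧ y = p) ∨ ∃ p, y = f p ∧ x = p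
      adj_sub := ?_
      edge_vert := ?_
      symm := ⟨fun _ _ h => h.symm⟩ }, ?_, Set.subset_union_left⟩
    · rintro x y (⟨p, rfl, rfl⟩ | ⟨p, rfl, rfl⟩)
      · exact Or.inl ⟨(h p).1, p.2, (h p).2⟩
      · exact Or.inr ⟨(h p).1, p.2, (h p).2⟩
    · rintro x y (⟨p, rfl, rfl⟩ | ⟨p, rfl, rfl⟩)
      · exact Or.inr ⟨p, rfl⟩
      · exact Or.inl p.2
    · rintro x (hx | ⟨p, rfl⟩)
      · refine ⟨f ⟨x, hx⟩, Or.inr ⟨⟨x, hx⟩, rfl, rfl⟩, ?_⟩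
        rintro y (⟨q, rfl, rfl⟩ | ⟨q, rfl, rfl⟩)
        · exact absurd (h q).1 (hdisj _ hx)
        · rfl
      · refine ⟨p, Or.inl ⟨p, rfl, rfl⟩, ?_⟩
        rintro y (⟨q, hq, rfl⟩ | ⟨q, rfl, hq⟩)
        · rw [hf hq]
        · exact absurd (h p).1 (hdisj _ (hq ▸ q.2))

end ListArcs

end Unipotent

theorem theorem4p3 {F : Type*} [Field F] [Fintype F] [DecidableEq F]
    (ϑ : AddChar F ℂ) (hϑ : ϑ ≠ 1)
    (n : ℕ) (K L : Finset (Fin n)) (hKL : K ⊆ L)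
    (lam mu : Multiset (Unipotent.Arc n F))
    (hlam : lam ∈ Unipotent.qSetPartitions F L) (hmu : mu ∈ Unipotent.qSetPartitions F K)
    (A : List (Unipotent.Arc n F))
    (hA : (A : Multiset (Unipotent.Arc n F)) = lam + Unipotent.bar mu) :
    Unipotent.charInner (Unipotent.Res hKL (Unipotent.chi ϑ L lam)) (Unipotent.chi ϑ K mu) ≠ 0 ↔
      Unipotent.HasCompleteMatching K A := by
  open Unipotent in
  have hs2 := eq_of_three_get hA Arc.left (fun _ => rfl) hlam.2.1 hmu.2.1
  have ht2 := eq_of_three_get hA Arc.right (fun _ => rfl) hlam.2.2 hmu.2.2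
  obtain ⟨ℓ, ρ, hsol, hℓ, hρ⟩ := exists_solvable_iff_stacked (K := K)
    (s := fun x => (A.get x).left) (t := fun x => (A.get x).right)
    (a := fun x => (A.get x).label) (fun p => (A.get p).label_ne) hs2 ht2
  have hL : ∀ p, (labelL K A p = .filled ↔ ℓ p ≠ 0) ∧ (labelL K A p = .hollow ↔ ℓ p = 0) := by
    intro p
    have h1 := hℓ p
    simp_rw [← startsBelow_iff hs2] at h1
    have h2 : (A.get p).left ∉ K ∨ (∃ q, StartsBelow A p q) ↔ ℓ p = 0 := by
      rw [← not_iff_not, ← ne_eq, h1, not_or, not_not]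
    rw [labelL]
    split_ifs with h
    · simp [h2.mp h]
    · have h0 : ℓ p ≠ 0 := fun h0 => h (h2.mpr h0)
      simp [h0]
  have hR : ∀ p, (labelR K A p = .filled ↔ ρ p ≠ 0) ∧ (labelR K A p = .hollow ↔ ρ p = 0) := by
    intro p
    have h1 := hρ p
    simp_rw [← endsBelow_iff hs2] at h1
    have h2 : (A.get p).right ∉ K ∨ (∃ q, EndsBelow A p q) ↔ ρ p = 0 := by
      rw [← not_iff_not, ← ne_eq, h1, not_or, not_not]
    rw [labelR]
    split_ifs with h
    · simp [h2.mp h]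
    · have h0 : ρ p ≠ 0 := fun h0 => h (h2.mpr h0)
      simp [h0]
  have hfilled : ∀ p, p ∈ VFilled K A ↔ ℓ p ≠ 0 ∧ ρ p ≠ 0 := fun p => by
    rw [← (hL p).1, ← (hR p).1]
    exact Prod.mk_inj
  have hhollow : ∀ p, p ∈ VHollow K A ↔ ℓ p = 0 ∧ ρ p = 0 := fun p => by
    rw [← (hL p).2, ← (hR p).2]
    exact Prod.mk_inj
  -- Of two distinct arcs starting at one node, one always starts below the other, so at most one
  -- keeps a filled left end.
  have hℓinj : Set.InjOn (fun x => (A.get x).left) {p | ℓ p ≠ 0} := by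
    intro p hp q hq hpq
    by_contra hne
    have hp' := not_exists.mp ((hℓ p).mp hp).2 q
    have hq' := not_exists.mp ((hℓ q).mp hq).2 p
    rcases lt_trichotomy (A.get p).right (A.get q).right with h | h | h
    · exact hp' ⟨hpq, Or.inl h⟩
    · by_cases h0 : (A.get p).label + (A.get q).label = 0 <;>
      rcases lt_or_gt_of_ne hne with h1 | h1
      · exact hq' ⟨hpq.symm, Or.inr ⟨h.symm, Or.inr ⟨h1, (add_comm _ _).trans h0⟩⟩⟩
      · exact hp' ⟨hpq, Or.inr ⟨h, Or.inr ⟨h1, h0⟩⟩⟩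
      · exact hp' ⟨hpq, Or.inr ⟨h, Or.inl ⟨h1, h0⟩⟩⟩
      · exact hq' ⟨hpq.symm, Or.inr ⟨h.symm, Or.inl ⟨h1, fun h2 =>
          h0 ((add_comm _ _).trans h2)⟩⟩⟩
    · exact hq' ⟨hpq.symm, Or.inl h⟩
  have hρinj : Set.InjOn (fun x => (A.get x).right) {p | ρ p ≠ 0} := by
    intro p hp q hq hpq
    by_contra hne
    have hp' := not_exists.mp ((hρ p).mp hp).2 q
    have hq' := not_exists.mp ((hρ q).mp hq).2 p
    rcases lt_trichotomy (A.get p).left (A.get q).left with h | h | h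
    · exact hq' ⟨hpq.symm, Or.inl h⟩
    · rcases lt_or_gt_of_ne hne with h1 | h1
      · exact hp' ⟨hpq, Or.inr ⟨h, h1⟩⟩
      · exact hq' ⟨hpq.symm, Or.inr ⟨h.symm, h1⟩⟩
    · exact hp' ⟨hpq, Or.inl h⟩
  have hbase : charInner (Res hKL (chi ϑ L lam)) (chi ϑ K mu) ≠ 0 ↔
      Solvable K (fun x => (A.get x).left) (fun x => (A.get x).right)
        (fun x => (A.get x).label) (fun _ => 1) fun _ => 1 := by
    rw [charInner_ne_zero_iff hϑ hKL lam mu A hA]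
    simp_rw [mem_leadingVectors, mem_trailingVectors]
    rfl
  rw [hbase, hsol, solvable_iff_exists_injective (fun p => (A.get p).lt)
    (fun p => (A.get p).label_ne) (fun p hp => ((hℓ p).mp hp).1) (fun p hp => ((hρ p).mp hp).1)
    hℓinj hρinj, hasCompleteMatching_iff_exists_injective]
  constructor
  · rintro ⟨f, hf, h⟩
    exact ⟨fun p => f ⟨p, (hfilled p).mp p.2⟩,
      fun p q hpq => Subtype.ext (Subtype.mk.inj (hf hpq)),
      fun p => ⟨(hhollow _).mpr (h _).1, (h _).2⟩⟩
  · rintro ⟨f, hf, h⟩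
    exact ⟨fun p => f ⟨p, (hfilled p).mpr p.2⟩,
      fun p q hpq => Subtype.ext (Subtype.mk.inj (hf hpq)),
      fun p => ⟨(hhollow _).mp (h _).1, (h _).2⟩⟩
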